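/- Let $\alpha\in(\tfrac13,1)$, and let $D^\alpha$ be the Fourier multiplier $\widehat{D^\alpha f}(\xi)=|\xi|^\alpha\hat f(\xi)$ on $\mathbb R$. For $c>1$ consider real solutions $\psi\in H^{\alpha/2}(\mathbb R)$ of the solitary wave equation of the fractional BBM equation with speed $c$, $$D^\alpha\psi+\Big(1-\frac1c\Big)\psi-\frac1c\psi^2=0,\qquad(1)$$ and define the scaling $(T_c\psi)(x)=\frac1{c-1}\,\psi\big((\tfrac{c}{c-1})^{1/\alpha}x\big)$. (a) For every $c>1$, $\psi\in H^{\alpha/2}(\mathbb R)$ solves (1) if and only if $\Psi=T_c\psi\in H^{\alpha/2}(\mathbb R)$ solves $D^\alpha\Psi+\Psi-\Psi^2=0$. In that case $\psi\in H^\alpha(\mathbb R)$, and the momentum $M=\frac12\langle(D^\alpha+1)\psi,\psi\rangle_{L^2}$ satisfies $$2M=\Big[\frac{1}{3\alpha-1}c^{\frac1\alpha-1}(c-1)^{3-\frac1\alpha}+c^{\frac1\alpha}(c-1)^{2-\frac1\alpha}\Big]\|\Psi\|_{L^2}^2 .$$ (b) The number $c_0=\frac{2+\sqrt{2(3\alpha-1)}}{6\alpha}$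 is the larger root of $6\alpha^2c^2-4\alpha c+1-\alpha$, and $c_0>1$ if $\alpha<\frac12$. (c) Let $(\psi_c)_{c>1}$ be a family of solutions of (1) such that either all $T_c\psi_c$ are translates of one nonzero function $\Psi$, or every $\psi_c$ is a ground state, i.e. an even, positive solution of (1) which minimizes $$J(v)=\frac{\big(\int|D^{\alpha/2}v|^2\big)^{\frac1{2\alpha}}\big(\int|v|^2\big)^{\frac{\alpha-1}{2\alpha}+1}}{\int|v|^3}$$ over $H^{\alpha/2}(\mathbb R)\setminus\{0\}$. Then $M(c)=\frac12\langle(D^\alpha+1)\psi_c,\psi_c\rangle_{L^2}$ is differentiable on $(1,\infty)$, and $M'(c)>0$ for $\alpha\in[\frac12,1)$ and all $c>1$; $M'(c)>0$ for $\alpha\in(\frac13,\frac12)$ and $c>c_0$; $M'(c)<0$ for $\alpha\in(\frac13,\frac12)$ and $1<c<c_0$. -/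

import Mathlib

open MeasureTheory Set
open scoped FourierTransform SchwartzMap

noncomputable section

namespace FBBM

/-- The `L²` Fourier transform of a real function `u ∈ L²(ℝ)`, with Mathlib's normalization
`û(ξ) = ∫ u(x) exp(-2πixξ) dx`. It is only used for square integrable `u` (value `0` otherwise). -/
def fourierL2 (u : ℝ → ℝ) : ℝ → ℂ :=
  open Classical in
  if h : MemLp (fun x => (u x : ℂ)) 2 volume then ⇑(𝓕 (h.toLp _) : Lp ℂ 2 (volume : Measure ℝ))
  else 0

/-- The Fourier symbol of `D^s`: it is `|k|^s` in the frequency variable `k = 2πξ` dual to the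
convention `∫ u(x) exp(-ikx) dx`. -/
def symb (s ξ : ℝ) : ℝ := |2 * Real.pi * ξ| ^ s

/-- The function `D^s u`, the inverse `L²` Fourier transform of `|2πξ|^s û(ξ)`. It is only used where
this product is square integrable, that is for `u ∈ H^s(ℝ)` with `s > 0` (value `0` otherwise). -/
def fracD (s : ℝ) (u : ℝ → ℝ) : ℝ → ℂ :=
  open Classical in
  if h : MemLp (fun ξ => (symb s ξ : ℂ) * fourierL2 u ξ) 2 volume then
    ⇑(𝓕⁻ (h.toLp _) : Lp ℂ 2 (volume : Measure ℝ))
  else 0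

/-- `u ∈ H^s(ℝ)` for a real function `u ∈ L²(ℝ)`. -/
def MemH (s : ℝ) (u : ℝ → ℝ) : Prop :=
  ∃ h : MemLp (fun x => (u x : ℂ)) 2 volume,
    TemperedDistribution.MemSobolev s 2 ((h.toLp _ : Lp ℂ 2 (volume : Measure ℝ)) : 𝓢'(ℝ, ℂ))

/-- `u ∈ H^{α/2}(ℝ)` is a (distributional) solution of `D^α u + ω u - κ u² = 0`. The equation is
written on the Fourier side; since `u ∈ L²`, the function `u²` is integrable and its Fourier
transform is the usual integral. -/
def Solves (α ω κ : ℝ) (u : ℝ → ℝ) : Prop :=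
  MemH (α / 2) u ∧
    ∀ᵐ ξ : ℝ, (symb α ξ : ℂ) * fourierL2 u ξ + (ω : ℂ) * fourierL2 u ξ
      - (κ : ℂ) * 𝓕 (fun x : ℝ => ((u x ^ 2 : ℝ) : ℂ)) ξ = 0

/-- Profiles of solitary waves of the fBBM equation with speed `c`:
`D^α ψ + (1 - 1/c) ψ - (1/c) ψ² = 0`. -/
def IsProfile (α c : ℝ) (ψ : ℝ → ℝ) : Prop := Solves α (1 - 1 / c) (1 / c) ψ

/-- The scaling `Ψ(x) = a ψ(b x)` with `a = 1/(c-1)` and `b = (c/(c-1))^{1/α}`. -/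
def rescale (α c : ℝ) (ψ : ℝ → ℝ) : ℝ → ℝ :=
  fun x => 1 / (c - 1) * ψ ((c / (c - 1)) ^ (1 / α) * x)

/-- The momentum `½ ⟨(D^α + 1) u, u⟩` of a real function `u`, with the `L²` inner product. -/
def momentum (α : ℝ) (u : ℝ → ℝ) : ℝ :=
  1 / 2 * (∫ x, (fracD α u x + (u x : ℂ)) * (u x : ℂ)).re

/-- The Weinstein functional `J^{α,p}` with `p = 1`. -/
def weinstein (α : ℝ) (v : ℝ → ℝ) : ℝ :=
  (∫ x, ‖fracD (α / 2) v x‖ ^ 2) ^ (1 / (2 * α)) *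
    (∫ x, |v x| ^ 2) ^ (1 / (2 * α) * (α - 1) + 1) / ∫ x, |v x| ^ 3

/-- Ground state profiles with speed `c`: even positive solutions in `H^{α/2}` which minimize the
Weinstein functional over `H^{α/2} \ {0}`. -/
def IsGroundState (α c : ℝ) (φ : ℝ → ℝ) : Prop :=
  IsProfile α c φ ∧ (∀ᵐ x : ℝ, φ (-x) = φ x) ∧ (∀ᵐ x : ℝ, 0 < φ x) ∧
    ∀ v : ℝ → ℝ, MemH (α / 2) v → ¬ (∀ᵐ x : ℝ, v x = 0) → weinstein α φ ≤ weinstein α v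

/-- The threshold speed. -/
def c₀ (α : ℝ) : ℝ := (2 + √(2 * (3 * α - 1))) / (6 * α)

/-- `M` is differentiable on `(1, ∞)` and its derivative has the following signs. -/
def HasMomentumSigns (α : ℝ) (M : ℝ → ℝ) : Prop :=
  (∀ c, 1 < c → DifferentiableAt ℝ M c) ∧
  (1 / 2 ≤ α → ∀ c, 1 < c → 0 < deriv M c) ∧
  (α < 1 / 2 → ∀ c, c₀ α < c → 0 < deriv M c) ∧
  (α < 1 / 2 → ∀ c, 1 < c → c < c₀ α → deriv M c < 0)

end FBBM

end

/-! Let `T = ∫ |k|^α |û|²`, `N = ∫ u²`, `Q = ∫ u³` for a solution `u` of `D^α u + ω u - κ u² = 0`.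
Pairing with `u` gives `T + ω N = κ Q`, and Pohozaev's identity gives `3α T = κ Q`; hence `(3α - 1)
T = ω N`. So `2M = T + N` is an explicit multiple of `‖ψ‖²`, and scaling turns `‖ψ‖²` into a power
expression in `c` times `‖Ψ‖²`. If `‖Ψ‖` does not depend on `c`, then `M'` is a positive factor
times `6α²c² - 4αc + 1 - α`.

For ground states no uniqueness is needed: by the same identities `J(ψ_c)` is a fixed increasing
function of `‖T_c ψ_c‖` (`IsGroundState.weinstein_eq`). All ground states minimize the same `J`, so
these norms agree.

The analytic core is `pohozaev`. Testing with `x u'` would require decay of `u`; instead `u` is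
compared with its dilations `u(l x)`, `l ↓ 1`. Symmetry and homogeneity of `D^α` give an exact
identity whose error `∫ (u(l x) - u(x))³` is `O((l - 1)²)`, because positivity of `D^α` bounds the
dilation differences in `L²` (`integral_dilation_sub_sq_le`). This only needs `u` bounded, Lipschitz
and vanishing at infinity, which a bootstrap on `|û|` provides (`Solves.exists_representative`); `α
> 1/3` is what starts it. -/

noncomputable section

/-! ### The `L²` Fourier transform: Plancherel, inversion, dilation, modulation. -/

namespace FBBM

open Complex

/-- `g` is a representative of the `L²` Fourier transform of `f ∈ L²(ℝ)`. -/
def IsFT (f g : ℝ → ℂ) : Prop :=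
  ∃ h : MemLp f 2 volume, ⇑(𝓕 (h.toLp f) : Lp ℂ 2 (volume : Measure ℝ)) =ᵐ[volume] g

namespace IsFT

variable {f f' g g' : ℝ → ℂ}

lemma memLp_left (h : IsFT f g) : MemLp f 2 volume := h.1

lemma memLp_right (h : IsFT f g) : MemLp g 2 volume := by
  obtain ⟨hf, h⟩ := h
  exact (Lp.memLp _).ae_eq h

lemma toLp_eq (h : IsFT f g) :
    (𝓕 (h.memLp_left.toLp f) : Lp ℂ 2 (volume : Measure ℝ)) = h.memLp_right.toLp g := by
  obtain ⟨hf, h'⟩ := h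
  exact Lp.ext (h'.trans (MemLp.coeFn_toLp _).symm)

lemma of_memLp (h : MemLp f 2 volume) :
    IsFT f ⇑(𝓕 (h.toLp f) : Lp ℂ 2 (volume : Measure ℝ)) := ⟨h, Filter.EventuallyEq.rfl⟩

lemma unique (h : IsFT f g) (h' : IsFT f g') : g =ᵐ[volume] g' := by
  obtain ⟨hf, h⟩ := h
  obtain ⟨hf', h'⟩ := h'
  exact h.symm.trans h'

lemma congr (h : IsFT f g) (hf : f =ᵐ[volume] f') (hg : g =ᵐ[volume] g') : IsFT f' g' := by
  obtain ⟨h1, h⟩ := h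
  refine ⟨h1.ae_eq hf, ?_⟩
  rw [← MemLp.toLp_congr h1 (h1.ae_eq hf) hf]
  exact h.trans hg

lemma const_mul (c : ℂ) (h : IsFT f g) : IsFT (fun x => c * f x) (fun x => c * g x) := by
  refine ⟨h.memLp_left.const_mul c, ?_⟩
  have : (h.memLp_left.const_mul c).toLp _ = c • h.memLp_left.toLp f := by
    rw [← MemLp.toLp_const_smul]; rfl
  rw [this, FourierTransform.fourier_smul, h.toLp_eq, ← MemLp.toLp_const_smul]
  exact MemLp.coeFn_toLp _

lemma sub (h : IsFT f g) (h' : IsFT f' g') :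
    IsFT (fun x => f x - f' x) (fun x => g x - g' x) := by
  refine ⟨h.memLp_left.sub h'.memLp_left, ?_⟩
  have : (h.memLp_left.sub h'.memLp_left).toLp _ = h.memLp_left.toLp f - h'.memLp_left.toLp f' := by
    rw [← MemLp.toLp_sub]
  have h2 : (𝓕 ((h.memLp_left.sub h'.memLp_left).toLp _) : Lp ℂ 2 (volume : Measure ℝ))
      = (h.memLp_right.sub h'.memLp_right).toLp _ := by
    rw [this, MemLp.toLp_sub h.memLp_right h'.memLp_right, ← h.toLp_eq, ← h'.toLp_eq]
    exact (Lp.fourierTransformₗᵢ ℝ ℂ).map_sub _ _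
  exact h2 ▸ MemLp.coeFn_toLp (h.memLp_right.sub h'.memLp_right)

/-- Plancherel's theorem. -/
lemma integral_conj_mul (h : IsFT f g) (h' : IsFT f' g') :
    ∫ x, f' x * (starRingEnd ℂ) (f x) = ∫ x, g' x * (starRingEnd ℂ) (g x) := by
  have := Lp.inner_fourier_eq (h.memLp_left.toLp f) (h'.memLp_left.toLp f')
  rw [h.toLp_eq, h'.toLp_eq, L2.inner_def, L2.inner_def] at this
  rw [← integral_congr_ae (f := fun x => inner ℂ (h.memLp_left.toLp f x) (h'.memLp_left.toLp f' x))
    (g := fun x => f' x * (starRingEnd ℂ) (f x)), ← this]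
  · refine integral_congr_ae ?_
    filter_upwards [h.memLp_right.coeFn_toLp, h'.memLp_right.coeFn_toLp] with x h1 h2
    rw [h1, h2]; rfl
  · filter_upwards [h.memLp_left.coeFn_toLp, h'.memLp_left.coeFn_toLp] with x h1 h2
    simp only [h1, h2]; rfl

lemma integral_schwartz (h : IsFT f g) (φ : 𝓢(ℝ, ℂ)) :
    ∫ x, φ x * g x = ∫ x, 𝓕 φ x * f x := by
  have := congrArg (fun T : 𝓢'(ℝ, ℂ) => T φ)
    (Lp.fourier_toTemperedDistribution_eq (h.memLp_left.toLp f))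
  simp only [TemperedDistribution.fourier_apply, Lp.toTemperedDistribution_apply, h.toLp_eq] at this
  rw [integral_congr_ae (g := fun x => 𝓕 φ x * f x), integral_congr_ae (f := fun x => φ x • _)
    (g := fun x => φ x * g x)] at this
  · exact this.symm
  · filter_upwards [h.memLp_right.coeFn_toLp] with x h1
    rw [h1]; rfl
  · filter_upwards [h.memLp_left.coeFn_toLp] with x h1
    rw [h1]; rfl

end IsFT

lemma ae_eq_of_integral_schwartz {f g : ℝ → ℂ} (hf : LocallyIntegrable f) (hg : LocallyIntegrable g)
    (h : ∀ φ : 𝓢(ℝ, ℂ), ∫ x, φ x * f x = ∫ x, φ x * g x) : f =ᵐ[volume] g := by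
  apply ae_eq_of_integral_contDiff_smul_eq hf hg
  intro φ hφ hc
  have h1 : HasCompactSupport (Complex.ofRealCLM ∘ φ) := hc.comp_left rfl
  exact h (h1.toSchwartzMap (Complex.ofRealCLM.contDiff.comp hφ))

namespace IsFT

variable {f f' g g' : ℝ → ℂ}

/-- Duality with Schwartz functions determines the transform, so its behaviour on integrable
functions, dilations and modulations follows from that on Schwartz functions, without density
arguments. -/
lemma of_integral_schwartz (hf : MemLp f 2 volume) (hg : LocallyIntegrable g)
    (h : ∀ φ : 𝓢(ℝ, ℂ), ∫ x, φ x * g x = ∫ x, 𝓕 φ x * f x) : IsFT f g := by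
  refine ⟨hf, ae_eq_of_integral_schwartz ?_ hg fun φ => ?_⟩
  · exact (Lp.memLp _).locallyIntegrable (by norm_num)
  · rw [(of_memLp hf).integral_schwartz, h]

lemma of_integrable (hf : MemLp f 2 volume) (hi : Integrable f) : IsFT f (𝓕 f) := by
  refine of_integral_schwartz hf ?_ fun φ => ?_
  · apply Continuous.locallyIntegrable
    exact VectorFourier.fourierIntegral_continuous Real.continuous_fourierChar
      (by exact continuous_inner) hi
  · have := VectorFourier.integral_fourierIntegral_smul_eq_flip (L := innerₗ ℝ)
      (μ := volume) (ν := volume) (f := (φ : ℝ → ℂ)) (g := f)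
      Real.continuous_fourierChar (by exact continuous_inner) φ.integrable hi
    simp only [flip_innerₗ, smul_eq_mul] at this
    rw [SchwartzMap.fourier_coe]
    exact this.symm

/-- The inversion formula. -/
lemma ae_eq_fourierInv (h : IsFT f g) (hg : Integrable g) : f =ᵐ[volume] 𝓕⁻ g := by
  refine ae_eq_of_integral_schwartz (h.memLp_left.locallyIntegrable (by norm_num)) ?_ fun φ => ?_
  · apply Continuous.locallyIntegrable
    have : 𝓕⁻ g = fun x => 𝓕 g (-x) := by ext x; exact Real.fourierInv_eq_fourier_neg g x
    rw [this]
    have h2 : Continuous (𝓕 g) := VectorFourier.fourierIntegral_continuous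
      Real.continuous_fourierChar (by exact continuous_inner) hg
    exact h2.comp continuous_neg
  · obtain ⟨ψ, rfl⟩ : ∃ ψ : 𝓢(ℝ, ℂ), φ = 𝓕 ψ := ⟨𝓕⁻ φ, by simp⟩
    rw [← h.integral_schwartz]
    have := VectorFourier.integral_fourierIntegral_smul_eq_flip (L := -innerₗ ℝ)
      (μ := volume) (ν := volume) (f := (𝓕 ψ : 𝓢(ℝ, ℂ))) (g := g)
      Real.continuous_fourierChar (by exact continuous_inner.neg) (𝓕 ψ).integrable hg
    have h2 : ∀ x, VectorFourier.fourierIntegral Real.fourierChar volume (-innerₗ ℝ)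
        (𝓕 ψ : 𝓢(ℝ, ℂ)) x = ψ x := fun x => by
      have : ((𝓕⁻ (𝓕 ψ) : 𝓢(ℝ, ℂ)) : ℝ → ℂ) x = ψ x := by simp
      rw [← this, SchwartzMap.fourierInv_coe]
      rfl
    simp only [h2, smul_eq_mul] at this
    have h3 : (-innerₗ ℝ).flip = -innerₗ ℝ := by ext; simp
    rw [this, h3]
    rfl

end IsFT

lemma integral_inv_mul_comp {b : ℝ} (hb : 0 < b) (F : ℝ → ℂ) :
    ∫ x, (b : ℂ)⁻¹ * F (b⁻¹ * x) = ∫ x, F x := by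
  rw [integral_const_mul, Measure.integral_comp_mul_left F b⁻¹]
  simp [abs_of_pos hb, hb.ne']

lemma fourier_comp_mul {b : ℝ} (hb : 0 < b) (f : ℝ → ℂ) (ξ : ℝ) :
    𝓕 (fun x => f (b * x)) ξ = (b : ℂ)⁻¹ * 𝓕 f (b⁻¹ * ξ) := by
  rw [Real.fourier_real_eq_integral_exp_smul, Real.fourier_real_eq_integral_exp_smul]
  rw [← integral_inv_mul_comp hb, integral_const_mul]
  congr 1
  refine integral_congr_ae (Filter.Eventually.of_forall fun x => ?_)
  have h1 : b * (b⁻¹ * x) = x := by field_simp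
  have h2 : -2 * Real.pi * (b⁻¹ * x) * ξ = -2 * Real.pi * x * (b⁻¹ * ξ) := by ring
  simp only [h1, h2]

lemma memLp_comp_mul {E : Type*} [NormedAddCommGroup E] {f : ℝ → E} {p : ENNReal} {b : ℝ}
    (hb : b ≠ 0) (h : MemLp f p volume) : MemLp (fun x => f (b * x)) p volume := by
  have h1 : MemLp f p (Measure.map (b * ·) volume) := by
    rw [Real.map_volume_mul_left hb]
    exact h.smul_measure ENNReal.ofReal_ne_top
  exact h1.comp_of_map (by fun_prop)

namespace IsFT

variable {f f' g g' : ℝ → ℂ}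

lemma comp_mul {b : ℝ} (hb : 0 < b) (h : IsFT f g) :
    IsFT (fun x => f (b * x)) (fun ξ => (b : ℂ)⁻¹ * g (b⁻¹ * ξ)) := by
  have hb' : b⁻¹ ≠ 0 := inv_ne_zero hb.ne'
  refine of_integral_schwartz (memLp_comp_mul hb.ne' h.memLp_left)
    (((memLp_comp_mul hb' h.memLp_right).const_mul _).locallyIntegrable (by norm_num)) fun φ => ?_
  let e : ℝ ≃L[ℝ] ℝ := ContinuousLinearEquiv.unitsEquivAut ℝ (Units.mk0 b hb.ne')
  let φb : 𝓢(ℝ, ℂ) := SchwartzMap.compCLMOfContinuousLinearEquiv ℂ e φ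
  have hφb : (φb : ℝ → ℂ) = fun x => φ (b * x) := by
    ext x
    change φ (e x) = _
    simp [e, mul_comm]
  have h1 := h.integral_schwartz φb
  have h2 : ∀ x, 𝓕 φb x = (b : ℂ)⁻¹ * 𝓕 φ (b⁻¹ * x) := fun x => by
    rw [SchwartzMap.fourier_coe, hφb, fourier_comp_mul hb, SchwartzMap.fourier_coe]
  rw [← integral_inv_mul_comp hb (fun x => 𝓕 φ x * f (b * x))]
  rw [← integral_inv_mul_comp hb] at h1
  simp only [hφb, h2, mul_inv_cancel_left₀ hb.ne', mul_assoc] at h1 ⊢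
  rw [← h1]
  congr 1
  ext x
  ring

/-- Modulations turn into translations. -/
lemma modulate (a : ℝ) (h : IsFT f g) :
    IsFT (fun x => cexp (2 * Real.pi * a * x * I) * f x) (fun ξ => g (ξ - a)) := by
  have hf : MemLp (fun x : ℝ => cexp (2 * Real.pi * a * x * I) * f x) 2 volume := by
    refine h.memLp_left.of_le (AEStronglyMeasurable.mul (by fun_prop) h.memLp_left.1)
      (Filter.Eventually.of_forall fun x => ?_)
    rw [norm_mul]
    have : (2 * Real.pi * a * x * I : ℂ) = ((2 * Real.pi * a * x : ℝ) : ℂ) * I := by push_cast; ring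
    rw [this, Complex.norm_exp_ofReal_mul_I, one_mul]
  refine of_integral_schwartz hf ?_ fun φ => ?_
  · exact (h.memLp_right.comp_measurePreserving
      (measurePreserving_sub_right volume a)).locallyIntegrable (by norm_num)
  let ψ : 𝓢(ℝ, ℂ) := SchwartzMap.compSubConstCLM ℂ (-a) φ
  have h1 := h.integral_schwartz ψ
  have h2 : ∀ x, 𝓕 ψ x = 𝓕 φ x * cexp (2 * Real.pi * a * x * I) := fun x => by
    simp only [SchwartzMap.fourier_coe, Real.fourier_real_eq_integral_exp_smul]
    rw [← integral_mul_const, ← integral_sub_right_eq_self _ a]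
    refine integral_congr_ae (Filter.Eventually.of_forall fun y => ?_)
    simp only [ψ, SchwartzMap.compSubConstCLM_apply, sub_neg_eq_add, sub_add_cancel, smul_eq_mul]
    rw [mul_right_comm (cexp _) (φ y), ← Complex.exp_add]
    push_cast
    ring_nf
  rw [← integral_sub_right_eq_self _ a] at h1
  simp only [h2, mul_assoc] at h1 ⊢
  rw [← h1]
  simp only [ψ, SchwartzMap.compSubConstCLM_apply, sub_neg_eq_add, sub_add_cancel]

end IsFT

end FBBM
end

/-! ### Sobolev spaces and the equation on the Fourier side. -/

noncomputable section

namespace FBBM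

open Complex

lemma isFT_fourierL2 {u : ℝ → ℝ} (h : MemLp (fun x => (u x : ℂ)) 2 volume) :
    IsFT (fun x => (u x : ℂ)) (fourierL2 u) := by
  rw [fourierL2, dif_pos h]
  exact IsFT.of_memLp h

lemma stronglyMeasurable_fourierL2 (u : ℝ → ℝ) : StronglyMeasurable (fourierL2 u) := by
  rw [fourierL2]
  split_ifs with h
  · exact Lp.stronglyMeasurable _
  · exact stronglyMeasurable_zero

lemma isFT_fracD {s : ℝ} {u : ℝ → ℝ}
    (h : MemLp (fun ξ => (symb s ξ : ℂ) * fourierL2 u ξ) 2 volume) :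
    IsFT (fracD s u) (fun ξ => (symb s ξ : ℂ) * fourierL2 u ξ) := by
  rw [fracD, dif_pos h]
  refine (IsFT.of_memLp (Lp.memLp _)).congr Filter.EventuallyEq.rfl ?_
  rw [Lp.toLp_coeFn, FourierTransform.fourier_fourierInv_eq]
  exact h.coeFn_toLp

lemma memSobolev_iff {s : ℝ} {f g : ℝ → ℂ} (h : IsFT f g) :
    TemperedDistribution.MemSobolev s 2
      ((h.memLp_left.toLp f : Lp ℂ 2 (volume : Measure ℝ)) : 𝓢'(ℝ, ℂ)) ↔
      MemLp (fun ξ => (((1 + ‖ξ‖ ^ 2) ^ (s / 2) : ℝ) : ℂ) * g ξ) 2 volume := by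
  rw [TemperedDistribution.memSobolev_iff_exists_smulLeftCLM_fourier]
  have hw : Function.HasTemperateGrowth (fun ξ : ℝ => (((1 + ‖ξ‖ ^ 2) ^ (s / 2) : ℝ) : ℂ)) := by
    fun_prop
  have key : ∀ φ : 𝓢(ℝ, ℂ), TemperedDistribution.smulLeftCLM ℂ
      (fun ξ : ℝ => (((1 + ‖ξ‖ ^ 2) ^ (s / 2) : ℝ) : ℂ))
      (𝓕 ((h.memLp_left.toLp f : Lp ℂ 2 (volume : Measure ℝ)) : 𝓢'(ℝ, ℂ))) φ =
      ∫ ξ, φ ξ * ((((1 + ‖ξ‖ ^ 2) ^ (s / 2) : ℝ) : ℂ) * g ξ) := fun φ => by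
    rw [Lp.fourier_toTemperedDistribution_eq, h.toLp_eq,
      TemperedDistribution.smulLeftCLM_apply_apply, Lp.toTemperedDistribution_apply]
    refine integral_congr_ae ?_
    filter_upwards [h.memLp_right.coeFn_toLp] with x hx
    rw [hx, SchwartzMap.smulLeftCLM_apply_apply hw]
    simp only [smul_eq_mul]
    ring
  constructor
  · rintro ⟨f', hf'⟩
    refine (Lp.memLp f').ae_eq (ae_eq_of_integral_schwartz
      ((Lp.memLp f').locallyIntegrable (by norm_num)) ?_ fun φ => ?_)
    · rw [← locallyIntegrableOn_univ]
      exact LocallyIntegrableOn.continuousOn_mul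
        ((h.memLp_right.locallyIntegrable (by norm_num)).locallyIntegrableOn _)
        hw.1.continuous.continuousOn isOpen_univ.isLocallyClosed
    · rw [← key, hf', Lp.toTemperedDistribution_apply]
      rfl
  · intro hg
    refine ⟨hg.toLp _, ?_⟩
    ext φ
    rw [key, Lp.toTemperedDistribution_apply]
    refine integral_congr_ae ?_
    filter_upwards [hg.coeFn_toLp] with x hx
    rw [hx]
    rfl

lemma symb_nonneg (s ξ : ℝ) : 0 ≤ symb s ξ := by
  unfold symb; positivity

lemma measurable_symb (s : ℝ) : Measurable (symb s) := by
  unfold symb; fun_prop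

lemma symb_mul {b : ℝ} (hb : 0 < b) (s ξ : ℝ) : symb s (b * ξ) = b ^ s * symb s ξ := by
  unfold symb
  rw [← Real.mul_rpow hb.le (abs_nonneg _)]
  congr 1
  rw [show 2 * Real.pi * (b * ξ) = b * (2 * Real.pi * ξ) by ring, abs_mul, abs_of_pos hb]

lemma symb_add (s t ξ : ℝ) (hs : 0 < s) (ht : 0 < t) :
    symb s ξ * symb t ξ = symb (s + t) ξ := by
  unfold symb
  rw [Real.rpow_add_of_nonneg (abs_nonneg _) hs.le ht.le]

lemma one_add_abs_rpow_le {s : ℝ} (hs : 0 ≤ s) (ξ : ℝ) :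
    (1 + |ξ|) ^ s ≤ 2 ^ s * (1 + symb s ξ) := by
  have h0 := abs_nonneg ξ
  rcases le_total |ξ| 1 with h | h
  · calc (1 + |ξ|) ^ s ≤ 2 ^ s := Real.rpow_le_rpow (by positivity) (by linarith) hs
      _ ≤ _ := le_mul_of_one_le_right (by positivity) (by linarith [symb_nonneg s ξ])
  · calc (1 + |ξ|) ^ s ≤ (2 * |2 * Real.pi * ξ|) ^ s := by
          refine Real.rpow_le_rpow (by positivity) ?_ hs
          rw [abs_mul, abs_of_pos Real.two_pi_pos]
          nlinarith [Real.pi_gt_three]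
      _ = 2 ^ s * symb s ξ := by rw [Real.mul_rpow (by norm_num) (abs_nonneg _)]; rfl
      _ ≤ _ := by gcongr; linarith

lemma symb_le {s : ℝ} (hs : 0 ≤ s) (ξ : ℝ) :
    symb s ξ ≤ (2 * Real.pi) ^ s * (1 + ‖ξ‖ ^ 2) ^ (s / 2) := by
  have h1 : |ξ| ≤ (1 + ‖ξ‖ ^ 2) ^ (1 / 2 : ℝ) := by
    rw [← Real.sqrt_eq_rpow, Real.norm_eq_abs]
    exact Real.le_sqrt_of_sq_le (by linarith)
  have h2 : (1 + ‖ξ‖ ^ 2) ^ (s / 2) = ((1 + ‖ξ‖ ^ 2) ^ (1 / 2 : ℝ)) ^ s := by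
    rw [← Real.rpow_mul (by positivity)]; ring_nf
  rw [h2, ← Real.mul_rpow (by positivity) (by positivity)]
  unfold symb
  refine Real.rpow_le_rpow (abs_nonneg _) ?_ hs
  rw [abs_mul, abs_of_pos Real.two_pi_pos]
  gcongr

lemma memLp_one_add_abs_rpow_mul {s : ℝ} (hs : 0 ≤ s) {g : ℝ → ℂ} (hg : MemLp g 2 volume)
    (h : MemLp (fun ξ => (symb s ξ : ℂ) * g ξ) 2 volume) :
    MemLp (fun ξ => (((1 + |ξ|) ^ s : ℝ) : ℂ) * g ξ) 2 volume := by
  refine (((hg.norm.add h.norm).const_mul (2 ^ s : ℝ))).mono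
    (AEStronglyMeasurable.mul (Complex.measurable_ofReal.comp
      (by fun_prop)).aestronglyMeasurable hg.1) (Filter.Eventually.of_forall fun ξ => ?_)
  rw [norm_mul, Complex.norm_of_nonneg (by positivity)]
  simp only [Pi.add_apply, norm_mul, Complex.norm_of_nonneg (symb_nonneg s ξ)]
  have h4 := symb_nonneg s ξ
  calc _ ≤ (2 ^ s * (1 + symb s ξ)) * ‖g ξ‖ := by
        gcongr; exact one_add_abs_rpow_le hs ξ
    _ = 2 ^ s * (‖g ξ‖ + symb s ξ * ‖g ξ‖) := by ring
    _ = _ := by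
        rw [Real.norm_of_nonneg (Real.rpow_nonneg (by norm_num) _),
          Real.norm_of_nonneg (by positivity)]

/-- As `g` is already in `L²`, the homogeneous symbol controls the Bessel weight: for `s ≥ 0` the
latter is bounded by a constant times `1 + symb s`. -/
lemma memH_iff {s : ℝ} (hs : 0 ≤ s) {u : ℝ → ℝ} {g : ℝ → ℂ}
    (h : IsFT (fun x => (u x : ℂ)) g) :
    MemH s u ↔ MemLp (fun ξ => (symb s ξ : ℂ) * g ξ) 2 volume := by
  have h1 : MemH s u ↔ MemLp (fun ξ => (((1 + ‖ξ‖ ^ 2) ^ (s / 2) : ℝ) : ℂ) * g ξ) 2 volume := by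
    rw [← memSobolev_iff h]
    exact ⟨fun ⟨_, h⟩ => h, fun h' => ⟨h.memLp_left, h'⟩⟩
  rw [h1]
  have hg := h.memLp_right
  constructor
  · intro h2
    refine (h2.const_mul (((2 * Real.pi) ^ s : ℝ) : ℂ)).mono
      ((Complex.measurable_ofReal.comp (measurable_symb s)).aestronglyMeasurable.mul hg.1)
      (Filter.Eventually.of_forall fun ξ => ?_)
    rw [← mul_assoc, norm_mul, norm_mul]
    refine mul_le_mul_of_nonneg_right ?_ (norm_nonneg _)
    rw [← Complex.ofReal_mul, Complex.norm_of_nonneg (symb_nonneg s ξ),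
      Complex.norm_of_nonneg (by positivity)]
    exact symb_le hs ξ
  · intro h2
    refine (memLp_one_add_abs_rpow_mul hs hg h2).mono
      (AEStronglyMeasurable.mul (Complex.measurable_ofReal.comp
        (by fun_prop)).aestronglyMeasurable hg.1) (Filter.Eventually.of_forall fun ξ => ?_)
    rw [norm_mul, norm_mul, Complex.norm_of_nonneg (by positivity),
      Complex.norm_of_nonneg (by positivity)]
    gcongr
    rw [show (1 + |ξ|) ^ s = ((1 + |ξ|) ^ (2 : ℝ)) ^ (s / 2) by
      rw [← Real.rpow_mul (by positivity)]; ring_nf]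
    refine Real.rpow_le_rpow (by positivity) ?_ (by positivity)
    rw [Real.norm_eq_abs, Real.rpow_two]
    nlinarith [abs_nonneg ξ]

/-- Reformulation of `Solves` with an arbitrary representative of the Fourier transform. -/
lemma solves_iff {α ω κ : ℝ} (hα : 0 ≤ α) {u : ℝ → ℝ} {g : ℝ → ℂ}
    (h : IsFT (fun x => (u x : ℂ)) g) :
    Solves α ω κ u ↔ MemLp (fun ξ => (symb (α / 2) ξ : ℂ) * g ξ) 2 volume ∧
      ∀ᵐ ξ : ℝ, ((symb α ξ + ω : ℝ) : ℂ) * g ξ =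
        (κ : ℂ) * 𝓕 (fun x : ℝ => ((u x ^ 2 : ℝ) : ℂ)) ξ := by
  rw [Solves, memH_iff (by linarith) h]
  have := (isFT_fourierL2 h.memLp_left).unique h
  refine and_congr Iff.rfl ⟨fun h1 => ?_, fun h1 => ?_⟩
  · filter_upwards [h1, this] with ξ h2 h3
    rw [← h3, Complex.ofReal_add]
    linear_combination h2
  · filter_upwards [h1, this] with ξ h2 h3
    rw [h3]
    rw [Complex.ofReal_add] at h2
    linear_combination h2

lemma Solves.memLp {α ω κ : ℝ} {u : ℝ → ℝ} (h : Solves α ω κ u) :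
    MemLp (fun x => (u x : ℂ)) 2 volume := h.1.1

lemma Solves.congr {α ω κ : ℝ} (hα : 0 ≤ α) {u v : ℝ → ℝ} (h : Solves α ω κ u)
    (huv : u =ᵐ[volume] v) : Solves α ω κ v := by
  have h1 := isFT_fourierL2 h.memLp
  have h2 : IsFT (fun x => (v x : ℂ)) (fourierL2 u) := h1.congr
    (by filter_upwards [huv] with x hx; rw [hx]) Filter.EventuallyEq.rfl
  rw [solves_iff hα h1] at h
  rw [solves_iff hα h2]
  refine ⟨h.1, ?_⟩
  have : 𝓕 (fun x : ℝ => ((v x ^ 2 : ℝ) : ℂ)) = 𝓕 (fun x : ℝ => ((u x ^ 2 : ℝ) : ℂ)) := by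
    ext ξ
    rw [Real.fourier_real_eq, Real.fourier_real_eq]
    exact integral_congr_ae (by filter_upwards [huv] with x hx; rw [hx])
  rw [this]
  exact h.2

/-- The amplitude and the dilation are left free so that both `rescale` and its inverse are
instances. -/
lemma Solves.scale {α ω κ a b : ℝ} (hα : 0 ≤ α) (ha : a ≠ 0) (hb : 0 < b) {u : ℝ → ℝ}
    (h : Solves α ω κ u) :
    Solves α (ω * b ^ α) (κ * b ^ α / a) (fun x => a * u (b * x)) := by
  have h1 := isFT_fourierL2 h.memLp
  have h2 : IsFT (fun x => ((a * u (b * x) : ℝ) : ℂ))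
      (fun ξ => (a : ℂ) * ((b : ℂ)⁻¹ * fourierL2 u (b⁻¹ * ξ))) := by
    simpa using (h1.comp_mul hb).const_mul (a : ℂ)
  rw [solves_iff hα h1] at h
  rw [solves_iff hα h2]
  have hb' : (b : ℂ) ≠ 0 := by exact_mod_cast hb.ne'
  have ha' : (a : ℂ) ≠ 0 := by exact_mod_cast ha
  have hs : ∀ s ξ, symb s ξ = b ^ s * symb s (b⁻¹ * ξ) := fun s ξ => by
    rw [← symb_mul hb, mul_inv_cancel_left₀ hb.ne']
  constructor
  · have h3 := (memLp_comp_mul (inv_ne_zero hb.ne') h.1).const_mul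
      ((a : ℂ) * (b : ℂ)⁻¹ * ((b ^ (α / 2) : ℝ) : ℂ))
    refine h3.ae_eq (Filter.Eventually.of_forall fun ξ => ?_)
    simp only [hs (α / 2) ξ]
    push_cast
    ring
  · have h4 : ∀ᵐ ξ : ℝ, ((symb α (b⁻¹ * ξ) + ω : ℝ) : ℂ) * fourierL2 u (b⁻¹ * ξ) =
        (κ : ℂ) * 𝓕 (fun x : ℝ => ((u x ^ 2 : ℝ) : ℂ)) (b⁻¹ * ξ) := by
      have hq : Measure.QuasiMeasurePreserving (fun ξ : ℝ => b⁻¹ * ξ) volume volume := by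
        refine ⟨by fun_prop, ?_⟩
        rw [Real.map_volume_mul_left (inv_ne_zero hb.ne')]
        exact Measure.smul_absolutelyContinuous
      exact hq.ae h.2
    have h5 : ∀ ξ, 𝓕 (fun x : ℝ => (((a * u (b * x)) ^ 2 : ℝ) : ℂ)) ξ =
        (a : ℂ) ^ 2 * ((b : ℂ)⁻¹ * 𝓕 (fun x : ℝ => ((u x ^ 2 : ℝ) : ℂ)) (b⁻¹ * ξ)) := fun ξ => by
      rw [← fourier_comp_mul hb (fun x => ((u x ^ 2 : ℝ) : ℂ)), Real.fourier_real_eq,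
        Real.fourier_real_eq, ← integral_const_mul]
      refine integral_congr_ae (Filter.Eventually.of_forall fun x => ?_)
      simp only [Circle.smul_def, smul_eq_mul]
      push_cast
      ring
    filter_upwards [h4] with ξ h6
    rw [h5, hs α ξ]
    push_cast at h6 ⊢
    have : (κ : ℂ) * ((b ^ α : ℝ) : ℂ) / a * (a ^ 2 *
        ((b : ℂ)⁻¹ * 𝓕 (fun x : ℝ => ((u x : ℂ) ^ 2)) (b⁻¹ * ξ))) =
        ((b ^ α : ℝ) : ℂ) * a * (b : ℂ)⁻¹ *
          (κ * 𝓕 (fun x : ℝ => ((u x : ℂ) ^ 2)) (b⁻¹ * ξ)) := by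
      field_simp
    rw [this, ← h6]
    ring

/-- Up to a reflection, the Fourier transform of `u²` is a convolution square. -/
lemma enorm_fourier_sq_le {u : ℝ → ℝ} {g : ℝ → ℂ} (h : IsFT (fun x => (u x : ℂ)) g) (ξ : ℝ) :
    ‖𝓕 (fun x : ℝ => ((u x ^ 2 : ℝ) : ℂ)) ξ‖ₑ ≤ ∫⁻ η, ‖g η‖ₑ * ‖g (η - ξ)‖ₑ := by
  -- Since `u` is real, `u² e^{-2πixξ}` is `u` times the conjugate of the modulated `u`, and
  -- Plancherel applies.
  have h1 : 𝓕 (fun x : ℝ => ((u x ^ 2 : ℝ) : ℂ)) ξ =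
      ∫ η, g η * (starRingEnd ℂ) (g (η - ξ)) := by
    rw [← (h.modulate ξ).integral_conj_mul h, Real.fourier_real_eq_integral_exp_smul]
    refine integral_congr_ae (Filter.Eventually.of_forall fun x => ?_)
    simp only [map_mul, Complex.conj_ofReal, ← Complex.exp_conj, Complex.conj_I, smul_eq_mul,
      map_ofNat]
    push_cast
    ring_nf
  rw [h1]
  refine (enorm_integral_le_lintegral_enorm _).trans (le_of_eq ?_)
  simp [enorm_mul]

end FBBM
end

/-! ### Bootstrap for `G = |û|` from `G ≤ C (1 + |ξ|)^{-α} (autocorrelation of G)`. -/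

noncomputable section

namespace FBBM

open scoped ENNReal

/-- The weight `(1 + |ξ|)^s`. -/
def weight (s ξ : ℝ) : ℝ≥0∞ := ENNReal.ofReal ((1 + |ξ|) ^ s)

/-- The autocorrelation of a nonnegative function. -/
def autocorr (G : ℝ → ℝ≥0∞) (ξ : ℝ) : ℝ≥0∞ := ∫⁻ η, G η * G (η - ξ)

@[fun_prop]
lemma measurable_weight (s : ℝ) : Measurable (weight s) := by
  unfold weight; fun_prop

lemma weight_mul (s t ξ : ℝ) : weight s ξ * weight t ξ = weight (s + t) ξ := by
  unfold weight
  rw [← ENNReal.ofReal_mul (by positivity), ← Real.rpow_add (by positivity)]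

lemma weight_zero (ξ : ℝ) : weight 0 ξ = 1 := by simp [weight]

lemma weight_rpow (s p ξ : ℝ) : weight s ξ ^ p = weight (s * p) ξ := by
  unfold weight
  rw [ENNReal.ofReal_rpow_of_pos (by positivity), ← Real.rpow_mul (by positivity)]

lemma weight_mono {s t : ℝ} (h : s ≤ t) (ξ : ℝ) : weight s ξ ≤ weight t ξ :=
  ENNReal.ofReal_le_ofReal (Real.rpow_le_rpow_of_exponent_le (by linarith [abs_nonneg ξ]) h)

lemma weight_le_mul {s : ℝ} (hs : 0 ≤ s) (ξ η : ℝ) :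
    weight s ξ ≤ weight s η * weight s (η - ξ) := by
  unfold weight
  rw [← ENNReal.ofReal_mul (by positivity), ← Real.mul_rpow (by positivity) (by positivity)]
  refine ENNReal.ofReal_le_ofReal (Real.rpow_le_rpow (by positivity) ?_ hs)
  have : |ξ| ≤ |η| + |η - ξ| := by
    calc |ξ| = |η - (η - ξ)| := by ring_nf
      _ ≤ _ := abs_sub _ _
  nlinarith [abs_nonneg η, abs_nonneg (η - ξ)]

lemma lintegral_weight_lt_top {r : ℝ} (hr : 1 < r) : ∫⁻ ξ, weight (-r) ξ < ⊤ := by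
  have := finite_integral_one_add_norm (E := ℝ) (μ := volume) (r := r) (by simpa using hr)
  simpa [weight, Real.norm_eq_abs] using this

/-- Integrability is indexed by the reciprocal exponent: `H ∈ L^{1/x}`. The weight allows `x` to
grow by any amount less than `β`, because `β / (y - x) > 1` makes the leftover weight integrable. -/
lemma lintegral_weight_mul_rpow_lt_top {H : ℝ → ℝ≥0∞} {β x y : ℝ}
    (hx : 0 < x) (hxy : x < y) (hy : y < x + β) (h : ∫⁻ ξ, H ξ ^ (1 / x) < ⊤) :
    ∫⁻ ξ, (weight (-β) ξ * H ξ) ^ (1 / y) < ⊤ := by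
  have hy0 : 0 < y := hx.trans hxy
  have hd : 0 < y - x := sub_pos.2 hxy
  have hpq : (y / (y - x)).HolderConjugate (y / x) := by
    refine ⟨?_, by positivity, by positivity⟩
    field_simp
    ring
  have key : ∀ ξ, (weight (-β) ξ * H ξ) ^ (1 / y) ≤
      weight (-(β / (y - x))) ξ + H ξ ^ (1 / x) := fun ξ => by
    rw [ENNReal.mul_rpow_of_nonneg _ _ (by positivity)]
    refine (ENNReal.young_inequality _ _ hpq).trans ?_
    have h1 : ∀ t : ℝ, 1 ≤ t → ∀ a : ℝ≥0∞, a / ENNReal.ofReal t ≤ a := fun t ht a =>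
      ENNReal.div_le_of_le_mul (le_mul_of_one_le_right (zero_le) (by simpa using ht))
    refine add_le_add ((h1 _ ?_ _).trans (le_of_eq ?_)) ((h1 _ ?_ _).trans (le_of_eq ?_))
    · rw [le_div_iff₀ hd]; linarith
    · rw [weight_rpow, weight_rpow]; congr 1; field_simp
    · rw [le_div_iff₀ hx]; linarith
    · rw [← ENNReal.rpow_mul]; congr 1; field_simp
  refine (lintegral_mono key).trans_lt ?_
  rw [lintegral_add_left (by fun_prop)]
  refine ENNReal.add_lt_top.2 ⟨lintegral_weight_lt_top ?_, h⟩
  rw [lt_div_iff₀ hd]; linarith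

lemma measurable_autocorr {G : ℝ → ℝ≥0∞} (hG : Measurable G) : Measurable (autocorr G) := by
  unfold autocorr
  exact Measurable.lintegral_prod_right' (f := fun p : ℝ × ℝ => G p.2 * G (p.2 - p.1))
    (by fun_prop)

lemma lintegral_autocorr {G : ℝ → ℝ≥0∞} (hG : Measurable G) :
    ∫⁻ ξ, autocorr G ξ = (∫⁻ ξ, G ξ) ^ 2 := by
  unfold autocorr
  rw [lintegral_lintegral_swap (by fun_prop)]
  have : ∀ η, ∫⁻ ξ, G η * G (η - ξ) = G η * ∫⁻ ξ, G ξ := fun η => by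
    rw [lintegral_const_mul _ (by fun_prop), lintegral_sub_left_eq_self G η]
  simp_rw [this]
  rw [lintegral_mul_const _ hG, sq]

lemma mul_rpow_half_le (a b : ℝ≥0∞) {p : ℝ} (hp : 0 ≤ p) : (a * b) ^ (p / 2) ≤ a ^ p + b ^ p := by
  have h : ∀ c : ℝ≥0∞, (c * c) ^ (p / 2) = c ^ p := fun c => by
    rw [← sq, ← ENNReal.rpow_natCast, ← ENNReal.rpow_mul]
    congr 1
    push_cast
    ring
  rcases le_total a b with hab | hab
  · calc (a * b) ^ (p / 2) ≤ (b * b) ^ (p / 2) := by gcongr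
      _ = b ^ p := h b
      _ ≤ _ := le_add_self
  · calc (a * b) ^ (p / 2) ≤ (a * a) ^ (p / 2) := by gcongr
      _ = a ^ p := h a
      _ ≤ _ := le_self_add

/-- A case of Young's convolution inequality. -/
lemma lintegral_autocorr_rpow_lt_top {G : ℝ → ℝ≥0∞} (hG : Measurable G) {x : ℝ}
    (hx : 1 / 2 < x) (hx1 : x < 1) (h : ∫⁻ ξ, G ξ ^ (1 / x) < ⊤) :
    ∫⁻ ξ, autocorr G ξ ^ (1 / (2 * x - 1)) < ⊤ := by
  have hx0 : 0 < x := by linarith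
  have hz : 0 < 2 * x - 1 := by linarith
  have hz1 : 0 < 2 - 2 * x := by linarith
  have hpq : (1 / (2 * x - 1)).HolderConjugate (1 / (2 - 2 * x)) := by
    refine ⟨?_, by positivity, by positivity⟩
    field_simp
    ring
  set S := ∫⁻ ξ, G ξ ^ (1 / x) with hS
  -- Hölder with exponents `1/(2x-1)` and `1/(2-2x)` after splitting the product `G η * G (η - ξ)`
  -- into its powers `(2x-1)/x` and `1/x - 1`; the second factor is bounded uniformly in `ξ`.
  have key : ∀ ξ, autocorr G ξ ≤ (autocorr (fun η => G η ^ (1 / x)) ξ) ^ (2 * x - 1) *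
      (S + S) ^ (2 - 2 * x) := fun ξ => by
    have h1 := ENNReal.lintegral_mul_le_Lp_mul_Lq volume hpq
      (f := fun η => ((G η * G (η - ξ)) ^ (1 / x)) ^ (2 * x - 1))
      (g := fun η => (G η * G (η - ξ)) ^ (1 / x - 1)) (by fun_prop) (by fun_prop)
    have h2 : ∀ η, ((fun η => ((G η * G (η - ξ)) ^ (1 / x)) ^ (2 * x - 1)) *
        (fun η => (G η * G (η - ξ)) ^ (1 / x - 1))) η = G η * G (η - ξ) := fun η => by
      simp only [Pi.mul_apply]
      rw [← ENNReal.rpow_mul, ← ENNReal.rpow_add_of_nonneg]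
      · rw [show 1 / x * (2 * x - 1) + (1 / x - 1) = 1 by field_simp; ring, ENNReal.rpow_one]
      · positivity
      · rw [sub_nonneg, le_div_iff₀ hx0]; linarith
    simp_rw [h2] at h1
    refine h1.trans (mul_le_mul' (le_of_eq ?_) ?_)
    · rw [one_div_one_div, autocorr]
      congr 2
      ext η
      rw [← ENNReal.rpow_mul, mul_one_div_cancel hz.ne', ENNReal.rpow_one,
        ENNReal.mul_rpow_of_nonneg _ _ (by positivity)]
    · rw [one_div_one_div]
      refine ENNReal.rpow_le_rpow ?_ hz1.le
      calc ∫⁻ η, ((G η * G (η - ξ)) ^ (1 / x - 1)) ^ (1 / (2 - 2 * x))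
          ≤ ∫⁻ η, (G η ^ (1 / x) + G (η - ξ) ^ (1 / x)) := by
            refine lintegral_mono fun η => ?_
            rw [← ENNReal.rpow_mul]
            have h3 : (1 / x - 1) * (1 / (2 - 2 * x)) = 1 / x / 2 := by
              have : 1 - x ≠ 0 := by linarith
              rw [show 2 - 2 * x = 2 * (1 - x) by ring]
              field_simp
            rw [h3]
            exact mul_rpow_half_le _ _ (by positivity)
        _ = S + S := by
            rw [lintegral_add_left (by fun_prop),
              lintegral_sub_right_eq_self (fun η => G η ^ (1 / x)) ξ]
  have hSS : ((S + S) ^ (2 - 2 * x)) ^ (1 / (2 * x - 1)) ≠ ⊤ :=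
    ENNReal.rpow_ne_top_of_nonneg (by positivity)
      (ENNReal.rpow_ne_top_of_nonneg hz1.le (ENNReal.add_ne_top.2 ⟨h.ne, h.ne⟩))
  calc ∫⁻ ξ, autocorr G ξ ^ (1 / (2 * x - 1))
      ≤ ∫⁻ ξ, autocorr (fun η => G η ^ (1 / x)) ξ *
          ((S + S) ^ (2 - 2 * x)) ^ (1 / (2 * x - 1)) := by
        refine lintegral_mono fun ξ => ?_
        refine (ENNReal.rpow_le_rpow (key ξ) (by positivity)).trans (le_of_eq ?_)
        rw [ENNReal.mul_rpow_of_nonneg _ _ (by positivity), ← ENNReal.rpow_mul,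
          mul_one_div_cancel hz.ne', ENNReal.rpow_one]
    _ = S ^ 2 * ((S + S) ^ (2 - 2 * x)) ^ (1 / (2 * x - 1)) := by
        rw [lintegral_mul_const _ (measurable_autocorr (by fun_prop)),
          lintegral_autocorr (by fun_prop)]
    _ < ⊤ := ENNReal.mul_lt_top (ENNReal.pow_lt_top h) hSS.lt_top

section Bootstrap

variable {G : ℝ → ℝ≥0∞} {α : ℝ} {C : ℝ≥0∞}

/-- Young's inequality sends `x` to `2x - 1`, and the weight adds anything below `α`; this gains
exactly when `x > 1 - α`. -/
lemma lintegral_rpow_lt_top_step (hG : Measurable G) (hC : C ≠ ⊤)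
    (h : ∀ᵐ ξ, G ξ ≤ C * (weight (-α) ξ * autocorr G ξ)) {x y : ℝ}
    (hx : 1 / 2 < x) (hx1 : x < 1) (hxy : x ≤ y) (hy : y < 2 * x - 1 + α)
    (hi : ∫⁻ ξ, G ξ ^ (1 / x) < ⊤) : ∫⁻ ξ, G ξ ^ (1 / y) < ⊤ := by
  have h1 := lintegral_weight_mul_rpow_lt_top (by linarith) (by linarith) hy
    (lintegral_autocorr_rpow_lt_top hG hx hx1 hi)
  have hy0 : 0 ≤ 1 / y := by have : 0 < y := by linarith
                             positivity
  calc ∫⁻ ξ, G ξ ^ (1 / y) ≤ ∫⁻ ξ, C ^ (1 / y) * (weight (-α) ξ * autocorr G ξ) ^ (1 / y) := by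
        refine lintegral_mono_ae ?_
        filter_upwards [h] with ξ hξ
        rw [← ENNReal.mul_rpow_of_nonneg _ _ hy0]
        exact ENNReal.rpow_le_rpow hξ hy0
    _ = C ^ (1 / y) * ∫⁻ ξ, (weight (-α) ξ * autocorr G ξ) ^ (1 / y) :=
        lintegral_const_mul' _ _ (ENNReal.rpow_ne_top_of_nonneg hy0 hC)
    _ < ⊤ := ENNReal.mul_lt_top (ENNReal.rpow_ne_top_of_nonneg hy0 hC).lt_top h1

lemma lintegral_lt_top_of_le_autocorr (hα : 1 / 3 < α) (hα1 : α < 1) (hG : Measurable G)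
    (hC : C ≠ ⊤) (h : ∀ᵐ ξ, G ξ ≤ C * (weight (-α) ξ * autocorr G ξ))
    (h2 : ∫⁻ ξ, (weight (α / 2) ξ * G ξ) ^ (2 : ℝ) < ⊤) : ∫⁻ ξ, G ξ < ⊤ := by
  -- The `H^{α/2}` bound reaches every `x` in `(1/2, 1/2 + α/2)`, while a gain needs `x > 1 - α`.
  -- Both are possible together exactly because `α > 1/3`.
  obtain ⟨x, hx⟩ : ∃ x, max (1 / 2) (1 - α) < x ∧ x < 1 / 2 + α / 2 :=
    exists_between (max_lt (by linarith) (by linarith))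
  obtain ⟨hxm, hx3⟩ := hx
  obtain ⟨hx1, hx2⟩ := max_lt_iff.1 hxm
  have h0 : ∫⁻ ξ, G ξ ^ (1 / x) < ⊤ := by
    have := lintegral_weight_mul_rpow_lt_top (H := fun ξ => weight (α / 2) ξ * G ξ) (x := 1 / 2)
      (β := α / 2) (by norm_num) hx1 (by linarith) (by simpa using h2)
    refine lt_of_eq_of_lt (lintegral_congr fun ξ => ?_) this
    rw [← mul_assoc, weight_mul, neg_add_cancel, weight_zero, one_mul]
  -- Half of the first available gain. The available gain grows with `x`, so every step can advance
  -- by `d` until the exponent `1` is reached.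
  set d := (x - (1 - α)) / 2 with hd
  have hd0 : 0 < d := by rw [hd]; linarith
  have hn : ∀ n : ℕ, ∫⁻ ξ, G ξ ^ (1 / min 1 (x + n * d)) < ⊤ := by
    intro n
    induction n with
    | zero =>
      rw [Nat.cast_zero, zero_mul, add_zero, min_eq_right (by linarith)]
      exact h0
    | succ n ih =>
      have hnd : 0 ≤ n * d := by positivity
      by_cases hc : x + n * d < 1
      · rw [min_eq_right hc.le] at ih
        refine lintegral_rpow_lt_top_step hG hC h (by linarith) hc ?_ ?_ ih
        · refine le_min hc.le ?_
          push_cast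
          linarith
        · refine (min_le_right _ _).trans_lt ?_
          push_cast
          linarith
      · rw [min_eq_left (not_lt.1 hc)] at ih
        rw [min_eq_left]
        · exact ih
        · push_cast
          linarith [not_lt.1 hc]
  obtain ⟨n, hn1⟩ := exists_nat_ge (1 / d)
  have := hn n
  rw [div_le_iff₀ hd0] at hn1
  rw [min_eq_left (by linarith)] at this
  simpa using this

/-- Submultiplicativity of the weight distributes `(1 + |ξ|)^s` over both factors of the
autocorrelation, and the decay factor supplies the extra `α`. -/
lemma lintegral_weight_mul_lt_top_step {s : ℝ} (hs : 0 ≤ s) (hG : Measurable G)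
    (hC : C ≠ ⊤) (h : ∀ᵐ ξ, G ξ ≤ C * (weight (-α) ξ * autocorr G ξ))
    (hi : ∫⁻ ξ, weight s ξ * G ξ < ⊤) : ∫⁻ ξ, weight (s + α) ξ * G ξ < ⊤ := by
  calc ∫⁻ ξ, weight (s + α) ξ * G ξ
      ≤ ∫⁻ ξ, C * autocorr (fun η => weight s η * G η) ξ := by
        refine lintegral_mono_ae ?_
        filter_upwards [h] with ξ hξ
        calc weight (s + α) ξ * G ξ
            ≤ weight (s + α) ξ * (C * (weight (-α) ξ * autocorr G ξ)) := by gcongr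
          _ = C * (weight s ξ * autocorr G ξ) := by
              rw [show s = (s + α) + -α by ring, ← weight_mul (s + α)]
              ring_nf
          _ ≤ _ := by
              refine mul_le_mul_right ?_ C
              unfold autocorr
              rw [← lintegral_const_mul _ (by fun_prop)]
              refine lintegral_mono fun η => ?_
              calc weight s ξ * (G η * G (η - ξ))
                  ≤ (weight s η * weight s (η - ξ)) * (G η * G (η - ξ)) := by
                    gcongr; exact weight_le_mul hs ξ η
                _ = _ := by ring
    _ = C * (∫⁻ ξ, weight s ξ * G ξ) ^ 2 := by
        rw [lintegral_const_mul _ (measurable_autocorr (by fun_prop)),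
          lintegral_autocorr (by fun_prop)]
    _ < ⊤ := ENNReal.mul_lt_top hC.lt_top (ENNReal.pow_lt_top hi)

/-- Three gains of `α` exceed `1`, which suffices for integrability of `ξ û`. -/
lemma lintegral_weight_mul_lt_top (hα : 1 / 3 < α) (hG : Measurable G)
    (hC : C ≠ ⊤) (h : ∀ᵐ ξ, G ξ ≤ C * (weight (-α) ξ * autocorr G ξ))
    (hi : ∫⁻ ξ, G ξ < ⊤) : ∫⁻ ξ, weight (3 * α) ξ * G ξ < ⊤ := by
  have h0 : ∫⁻ ξ, weight 0 ξ * G ξ < ⊤ := by simpa [weight_zero] using hi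
  have h1 := lintegral_weight_mul_lt_top_step le_rfl hG hC h h0
  have h2 := lintegral_weight_mul_lt_top_step (by linarith) hG hC h h1
  have h3 := lintegral_weight_mul_lt_top_step (by linarith) hG hC h h2
  rwa [show 0 + α + α + α = 3 * α by ring] at h3

end Bootstrap

end FBBM
end

/-! ### Regularity of solutions. -/

noncomputable section

namespace FBBM

open Filter Topology
open scoped ENNReal

section Regularity

variable {α ω κ : ℝ} {u : ℝ → ℝ}

/-- Because `ω > 0`, the symbol `|k|^α + ω` dominates a multiple of `(1 + |ξ|)^α` and can be divided
out. -/
lemma Solves.enorm_fourierL2_le (hα : 0 ≤ α) (hω : 0 < ω) (h : Solves α ω κ u) :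
    ∃ C : ℝ≥0∞, C ≠ ⊤ ∧ ∀ᵐ ξ, ‖fourierL2 u ξ‖ₑ ≤
      C * (weight (-α) ξ * autocorr (fun η => ‖fourierL2 u η‖ₑ) ξ) := by
  have hg := isFT_fourierL2 h.memLp
  have h1 := ((solves_iff hα hg).1 h).2
  set m := min 1 ω with hm
  have hm0 : 0 < m := lt_min one_pos hω
  refine ⟨ENNReal.ofReal (2 ^ α / m) * ‖(κ : ℂ)‖ₑ,
    ENNReal.mul_ne_top ENNReal.ofReal_ne_top enorm_ne_top, ?_⟩
  filter_upwards [h1] with ξ hξ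
  have h2 : weight α ξ * ‖fourierL2 u ξ‖ₑ ≤
      ENNReal.ofReal (2 ^ α / m) * ‖(κ : ℂ)‖ₑ * autocorr (fun η => ‖fourierL2 u η‖ₑ) ξ := by
    have h3 : (1 + |ξ|) ^ α ≤ 2 ^ α / m * (symb α ξ + ω) := by
      refine (one_add_abs_rpow_le hα ξ).trans ?_
      rw [div_mul_eq_mul_div, le_div_iff₀ hm0, mul_assoc]
      gcongr
      nlinarith [symb_nonneg α ξ, min_le_left 1 ω, min_le_right 1 ω]
    have h0 := symb_nonneg α ξ
    calc weight α ξ * ‖fourierL2 u ξ‖ₑ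
        ≤ ENNReal.ofReal (2 ^ α / m * (symb α ξ + ω)) * ‖fourierL2 u ξ‖ₑ := by
          gcongr; exact ENNReal.ofReal_le_ofReal h3
      _ = ENNReal.ofReal (2 ^ α / m) * ‖((symb α ξ + ω : ℝ) : ℂ) * fourierL2 u ξ‖ₑ := by
          rw [ENNReal.ofReal_mul (by positivity), enorm_mul, ← ofReal_norm (Complex.ofReal _),
            Complex.norm_of_nonneg (by positivity), mul_assoc]
      _ ≤ _ := by
          rw [hξ, enorm_mul, ← mul_assoc]
          gcongr
          exact enorm_fourier_sq_le hg ξ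
  calc ‖fourierL2 u ξ‖ₑ = weight (-α) ξ * (weight α ξ * ‖fourierL2 u ξ‖ₑ) := by
        rw [← mul_assoc, weight_mul, neg_add_cancel, weight_zero, one_mul]
    _ ≤ weight (-α) ξ * (ENNReal.ofReal (2 ^ α / m) * ‖(κ : ℂ)‖ₑ *
          autocorr (fun η => ‖fourierL2 u η‖ₑ) ξ) := by gcongr
    _ = _ := by ring

lemma Solves.integrable_fourierL2 (hα : 1 / 3 < α) (hα1 : α < 1) (hω : 0 < ω)
    (h : Solves α ω κ u) :
    Integrable (fourierL2 u) ∧ Integrable (fun ξ : ℝ => ξ • fourierL2 u ξ) := by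
  have hα0 : 0 ≤ α := by linarith
  obtain ⟨C, hC, hle⟩ := h.enorm_fourierL2_le hα0 hω
  have hg := isFT_fourierL2 h.memLp
  have hm : Measurable (fourierL2 u) := (stronglyMeasurable_fourierL2 u).measurable
  have h2 : ∫⁻ ξ, (weight (α / 2) ξ * ‖fourierL2 u ξ‖ₑ) ^ (2 : ℝ) < ⊤ := by
    have := memLp_one_add_abs_rpow_mul (by linarith) hg.memLp_right
      ((solves_iff hα0 hg).1 h).1
    have h3 := lintegral_rpow_enorm_lt_top_of_eLpNorm_lt_top (by norm_num) (by norm_num) this.2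
    refine lt_of_eq_of_lt (lintegral_congr fun ξ => ?_) h3
    rw [enorm_mul, ← ofReal_norm (Complex.ofReal _), Complex.norm_of_nonneg (by positivity)]
    simp [weight]
  have h3 := lintegral_lt_top_of_le_autocorr hα hα1 hm.enorm hC hle h2
  have h4 := lintegral_weight_mul_lt_top hα hm.enorm hC hle h3
  refine ⟨⟨hm.aestronglyMeasurable, h3⟩,
    (measurable_id.smul hm).aestronglyMeasurable, lt_of_le_of_lt (lintegral_mono fun ξ => ?_) h4⟩
  rw [enorm_smul]
  gcongr
  refine le_trans ?_ (weight_mono (s := 1) (by linarith) ξ)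
  rw [weight, Real.rpow_one, ← ofReal_norm]
  refine ENNReal.ofReal_le_ofReal ?_
  rw [Real.norm_eq_abs]
  linarith

/-- Solutions have a bounded, Lipschitz continuous representative that vanishes at infinity. -/
lemma Solves.exists_representative (hα : 1 / 3 < α) (hα1 : α < 1) (hω : 0 < ω)
    (h : Solves α ω κ u) :
    ∃ U : ℝ → ℝ, u =ᵐ[volume] U ∧ Continuous U ∧ (∃ B, ∀ x, |U x| ≤ B) ∧
      (∃ K, ∀ x y, |U x - U y| ≤ K * |x - y|) ∧ Tendsto U (cocompact ℝ) (𝓝 0) := by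
  obtain ⟨h1, h2⟩ := h.integrable_fourierL2 hα hα1 hω
  have hg := isFT_fourierL2 h.memLp
  set g := fourierL2 u
  -- Integrability of `ξ g` gives a bounded derivative, hence the Lipschitz bound; decay at infinity
  -- will be the Riemann–Lebesgue lemma.
  have hd := Real.hasDerivAt_fourier h1 h2
  have hF : ∀ x, 𝓕⁻ g x = 𝓕 g (-x) := fun x => Real.fourierInv_eq_fourier_neg g x
  have hnorm : ∀ (f : ℝ → ℂ) (x : ℝ), ‖𝓕 f x‖ ≤ ∫ ξ, ‖f ξ‖ := fun f x =>
    VectorFourier.norm_fourierIntegral_le_integral_norm _ _ _ _ _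
  have hlip : ∀ x y, ‖𝓕 g x - 𝓕 g y‖ ≤
      (∫ ξ : ℝ, ‖(-2 * Real.pi * Complex.I * ξ) • g ξ‖) * ‖x - y‖ := fun x y =>
    Convex.norm_image_sub_le_of_norm_hasDerivWithin_le
      (fun z _ => (hd z).hasDerivWithinAt) (fun z _ => hnorm _ z) convex_univ
      (mem_univ y) (mem_univ x)
  have hcont : Continuous (𝓕 g) := continuous_iff_continuousAt.2 fun x => (hd x).continuousAt
  refine ⟨fun x => (𝓕 g (-x)).re, ?_, ?_, ⟨∫ ξ, ‖g ξ‖, fun x => ?_⟩,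
    ⟨∫ ξ : ℝ, ‖(-2 * Real.pi * Complex.I * ξ) • g ξ‖, fun x y => ?_⟩, ?_⟩
  · filter_upwards [hg.ae_eq_fourierInv h1] with x hx
    rw [← hF, ← hx, Complex.ofReal_re]
  · exact Complex.continuous_re.comp (hcont.comp continuous_neg)
  · exact (Complex.abs_re_le_norm _).trans (hnorm g (-x))
  · rw [← Complex.sub_re]
    refine (Complex.abs_re_le_norm _).trans ((hlip (-x) (-y)).trans (le_of_eq ?_))
    rw [Real.norm_eq_abs, neg_sub_neg, abs_sub_comm]
  · have := (Complex.continuous_re.tendsto 0).comp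
      ((Real.zero_at_infty_fourier g).comp (Homeomorph.neg ℝ).isClosedEmbedding.tendsto_cocompact)
    simpa [Function.comp_def] using this

end Regularity

end FBBM
end

/-! ### Pohozaev's identity by dilations. -/

noncomputable section

namespace FBBM

open Filter Topology

lemma integral_comp_mul_pos {l : ℝ} (hl : 0 < l) (F : ℝ → ℝ) :
    ∫ x, F (l * x) = l⁻¹ * ∫ x, F x := by
  rw [Measure.integral_comp_mul_left F l, abs_of_pos (inv_pos.2 hl), smul_eq_mul]

section Pohozaev

variable {α ω κ B K : ℝ} {U : ℝ → ℝ}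

lemma memLp_quadratic (hc : Continuous U) (hB : ∀ x, |U x| ≤ B) (h2 : MemLp U 2 volume) :
    MemLp (fun x => κ * U x ^ 2 - ω * U x) 2 volume := by
  refine (h2.const_mul (|κ| * B + |ω|)).mono (by fun_prop) (Eventually.of_forall fun x => ?_)
  have hB0 : 0 ≤ B := (abs_nonneg _).trans (hB 0)
  rw [Real.norm_eq_abs, Real.norm_eq_abs, abs_mul (|κ| * B + |ω|),
    abs_of_nonneg (by positivity : 0 ≤ |κ| * B + |ω|),
    show κ * U x ^ 2 - ω * U x = (κ * U x - ω) * U x by ring, abs_mul]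
  gcongr
  calc |κ * U x - ω| ≤ |κ * U x| + |ω| := abs_sub _ _
    _ ≤ _ := by rw [abs_mul]; gcongr; exact hB x

lemma rpow_sub_one_le {l : ℝ} (hα : 0 < α) (hα1 : α < 1) (hl : 1 ≤ l) :
    0 ≤ l ^ α - 1 ∧ l ^ α - 1 ≤ l - 1 := by
  refine ⟨sub_nonneg.2 (Real.one_le_rpow hl hα.le), ?_⟩
  have := Real.rpow_le_rpow_of_exponent_le hl hα1.le
  rw [Real.rpow_one] at this
  linarith

/-- The dilation difference quotients of `U` are bounded in `L²`. -/
lemma integral_dilation_sub_sq_le (hα : 0 < α) (hα1 : α < 1) (hω : 0 < ω) (hc : Continuous U)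
    (hB : ∀ x, |U x| ≤ B) (hK : ∀ x y, |U x - U y| ≤ K * |x - y|)
    (h0 : Tendsto U (cocompact ℝ) (𝓝 0)) (h2 : MemLp U 2 volume)
    (hP : ∀ l : ℝ, 1 < l → 0 ≤ ∫ x, (l ^ α * (κ * U (l * x) ^ 2 - ω * U (l * x)) -
      (κ * U x ^ 2 - ω * U x)) * (U (l * x) - U x)) :
    ∃ C, ∀ l : ℝ, 1 < l → ∫ x, (U (l * x) - U x) ^ 2 ≤ C * (l - 1) ^ 2 := by
  have hB0 : 0 ≤ B := (abs_nonneg _).trans (hB 0)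
  -- Beyond `R` the coefficient `κ (U(l x) + U x) - ω` is at most `-ω/2`, so the positivity
  -- hypothesis bounds `W²` there; on `[-R, R]` the Lipschitz bound does.
  obtain ⟨R, hR0, hR⟩ : ∃ R : ℝ, 0 ≤ R ∧ ∀ x, R < |x| → |κ| * |U x| ≤ ω / 4 := by
    have h1 : Tendsto (fun x => |κ| * |U x|) (cocompact ℝ) (𝓝 0) := by
      simpa using (h0.abs).const_mul |κ|
    have h2 := h1.eventually (gt_mem_nhds (by positivity : (0 : ℝ) < ω / 4))
    obtain ⟨t, ht, hts⟩ := mem_cocompact.1 h2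
    obtain ⟨R, hR⟩ := ht.isBounded.subset_closedBall 0
    refine ⟨max R 0, le_max_right _ _, fun x hx => ?_⟩
    have h3 : x ∈ tᶜ := fun hxt => by
      have := hR hxt
      rw [mem_closedBall_zero_iff, Real.norm_eq_abs] at this
      exact absurd hx (not_lt.2 (this.trans (le_max_left _ _)))
    exact (hts h3).le
  set V : ℝ → ℝ := fun x => κ * U x ^ 2 - ω * U x with hV
  have hVm : MemLp V 2 volume := memLp_quadratic hc hB h2
  set M := 2 * |κ| * B * (K * R) ^ 2 with hM
  have hM0 : 0 ≤ M := by positivity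
  refine ⟨4 / ω * (M * (2 * R) + 1 / ω * ∫ x, V x ^ 2), fun l hl => ?_⟩
  have hl0 : 0 < l := by linarith
  set W : ℝ → ℝ := fun x => U (l * x) - U x with hW
  have hUl : MemLp (fun x => U (l * x)) 2 volume := memLp_comp_mul hl0.ne' h2
  have hVl : MemLp (fun x => V (l * x)) 2 volume := memLp_comp_mul hl0.ne' hVm
  have hWm : MemLp W 2 volume := hUl.sub h2
  obtain ⟨hr0, hr1⟩ := rpow_sub_one_le hα hα1 hl.le
  set I : ℝ → ℝ := (Icc (-R) R).indicator fun _ => M * (l - 1) ^ 2 with hI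
  have hIi : Integrable I := (integrable_indicator_iff measurableSet_Icc).2
    (integrableOn_const (by simp))
  have hpt : ∀ x, (l ^ α * V (l * x) - V x) * W x ≤
      -(ω / 4) * W x ^ 2 + I x + (l - 1) ^ 2 / ω * V (l * x) ^ 2 := by
    intro x
    have e1 : (l ^ α * V (l * x) - V x) * W x =
        (κ * (U (l * x) + U x) - ω) * W x ^ 2 + (l ^ α - 1) * V (l * x) * W x := by
      simp only [hV, hW]; ring
    -- Half of the coercive `ω/2` is spent on this term; `α < 1` gives `l^α - 1 ≤ l - 1`.
    have e2 : (l ^ α - 1) * V (l * x) * W x ≤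
        ω / 4 * W x ^ 2 + (l - 1) ^ 2 / ω * V (l * x) ^ 2 := by
      have h4 : ((l ^ α - 1) * V (l * x)) ^ 2 ≤ ((l - 1) * V (l * x)) ^ 2 := by
        rw [mul_pow, mul_pow]; gcongr
      have h5 : (l - 1) ^ 2 / ω * V (l * x) ^ 2 = ((l - 1) * V (l * x)) ^ 2 / ω := by ring
      rw [h5, ← sub_nonneg]
      have h6 : 0 ≤ (ω / 2 * W x - (l ^ α - 1) * V (l * x)) ^ 2 / ω := by positivity
      have h7 : (ω / 2 * W x - (l ^ α - 1) * V (l * x)) ^ 2 / ω =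
          ω / 4 * W x ^ 2 - (l ^ α - 1) * V (l * x) * W x +
            ((l ^ α - 1) * V (l * x)) ^ 2 / ω := by field_simp; ring
      have h8 : ((l ^ α - 1) * V (l * x)) ^ 2 / ω ≤ ((l - 1) * V (l * x)) ^ 2 / ω := by gcongr
      linarith
    have e3 : κ * (U (l * x) + U x) * W x ^ 2 ≤ ω / 2 * W x ^ 2 + I x := by
      have h4 : κ * (U (l * x) + U x) ≤ |κ| * |U (l * x)| + |κ| * |U x| := by
        rw [← mul_add]
        refine (le_abs_self _).trans ?_
        rw [abs_mul]
        gcongr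
        exact abs_add_le _ _
      by_cases hx : x ∈ Icc (-R) R
      · rw [hI, indicator_of_mem hx]
        have h5 : |W x| ≤ K * R * (l - 1) := by
          refine (hK _ _).trans ?_
          rw [show l * x - x = (l - 1) * x by ring, abs_mul, abs_of_pos (by linarith : 0 < l - 1)]
          have hK0 : 0 ≤ K := by simpa using (abs_nonneg _).trans (hK 1 0)
          have : |x| ≤ R := abs_le.2 hx
          calc K * ((l - 1) * |x|) ≤ K * ((l - 1) * R) := by
                have : 0 ≤ l - 1 := by linarith
                gcongr
            _ = _ := by ring
        have h6 : W x ^ 2 ≤ (K * R * (l - 1)) ^ 2 := sq_le_sq' (neg_le_of_abs_le h5)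
          (le_of_abs_le h5)
        calc κ * (U (l * x) + U x) * W x ^ 2 ≤ (2 * |κ| * B) * W x ^ 2 := by
              refine mul_le_mul_of_nonneg_right (h4.trans ?_) (sq_nonneg _)
              nlinarith [hB x, hB (l * x), abs_nonneg κ]
          _ ≤ (2 * |κ| * B) * (K * R * (l - 1)) ^ 2 := by gcongr
          _ = M * (l - 1) ^ 2 := by rw [hM]; ring
          _ ≤ _ := le_add_of_nonneg_left (by positivity)
      · rw [hI, indicator_of_notMem hx, add_zero]
        have hx1 : R < |x| := by
          rw [← not_le]; exact fun h => hx (abs_le.1 h)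
        have hx2 : R < |l * x| := by
          rw [abs_mul, abs_of_pos hl0]
          nlinarith [abs_nonneg x]
        refine mul_le_mul_of_nonneg_right ?_ (sq_nonneg _)
        linarith [hR _ hx1, hR _ hx2]
    rw [e1]
    nlinarith [sq_nonneg (W x)]
  have hi1 : Integrable (fun x => -(ω / 4) * W x ^ 2) := hWm.integrable_sq.const_mul _
  have hi2 : Integrable (fun x => (l - 1) ^ 2 / ω * V (l * x) ^ 2) :=
    hVl.integrable_sq.const_mul _
  have hi3 : Integrable (fun x => (l ^ α * V (l * x) - V x) * W x) :=
    ((hVl.const_mul _).sub hVm).integrable_mul hWm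
  have h4 := (hP l hl).trans (integral_mono hi3 ((hi1.add hIi).add hi2) hpt)
  have h5 : ∫ x, I x = 2 * R * (M * (l - 1) ^ 2) := by
    rw [hI, integral_indicator measurableSet_Icc, setIntegral_const, smul_eq_mul, measureReal_def,
      Real.volume_Icc, ENNReal.toReal_ofReal (by linarith)]
    ring
  have hi4 : Integrable (fun x => -(ω / 4) * W x ^ 2 + I x) := hi1.add hIi
  simp only [Pi.add_apply] at h4
  rw [integral_add hi4 hi2, integral_add hi1 hIi, integral_const_mul,
    integral_const_mul, h5, integral_comp_mul_pos hl0 (fun x => V x ^ 2)] at h4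
  have h6 : l⁻¹ * ∫ x, V x ^ 2 ≤ ∫ x, V x ^ 2 :=
    mul_le_of_le_one_left (integral_nonneg fun x => sq_nonneg _) (inv_le_one_of_one_le₀ hl.le)
  have h7 : (l - 1) ^ 2 / ω * (l⁻¹ * ∫ x, V x ^ 2) ≤ (l - 1) ^ 2 / ω * ∫ x, V x ^ 2 := by gcongr
  have h8 : ω / 4 * ∫ x, W x ^ 2 ≤
      (M * (2 * R) + 1 / ω * ∫ x, V x ^ 2) * (l - 1) ^ 2 := by
    have : (M * (2 * R) + 1 / ω * ∫ x, V x ^ 2) * (l - 1) ^ 2 =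
      2 * R * (M * (l - 1) ^ 2) + (l - 1) ^ 2 / ω * ∫ x, V x ^ 2 := by ring
    rw [this]
    linarith
  calc ∫ x, W x ^ 2 = 4 / ω * (ω / 4 * ∫ x, W x ^ 2) := by field_simp
    _ ≤ 4 / ω * ((M * (2 * R) + 1 / ω * ∫ x, V x ^ 2) * (l - 1) ^ 2) := by gcongr
    _ = _ := by ring

lemma eq_zero_of_hasDerivAt_of_le {F : ℝ → ℝ} {d E : ℝ} (h : HasDerivAt F d 1)
    (hF : ∀ l : ℝ, 1 < l → |F l - F 1| ≤ E * (l - 1) ^ 2) : d = 0 := by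
  have h1 : Tendsto (slope F 1) (𝓝[>] 1) (𝓝 d) :=
    (hasDerivAt_iff_tendsto_slope.1 h).mono_left (nhdsWithin_mono _ fun x hx => ne_of_gt hx)
  have h2 : Tendsto (slope F 1) (𝓝[>] 1) (𝓝 0) := by
    refine squeeze_zero_norm' (a := fun l => E * (l - 1)) ?_ ?_
    · filter_upwards [self_mem_nhdsWithin] with l (hl : 1 < l)
      have hl' : 0 < l - 1 := by linarith
      rw [slope_def_field, Real.norm_eq_abs, abs_div, abs_of_pos hl', div_le_iff₀ hl']
      linarith [hF l hl]
    · have : Tendsto (fun l : ℝ => E * (l - 1)) (𝓝 1) (𝓝 (E * (1 - 1))) := by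
        apply Continuous.tendsto; fun_prop
      rw [sub_self, mul_zero] at this
      exact this.mono_left nhdsWithin_le_nhds
  exact tendsto_nhds_unique h1 h2

/-- Pohozaev's identity. The hypotheses `hS` and `hP` say that `κ U² - ω U` is the image of `U`
under an operator that is symmetric, nonnegative and homogeneous of degree `α` under dilations. -/
lemma pohozaev (hα : 0 < α) (hα1 : α < 1) (hω : 0 < ω) (hc : Continuous U)
    (hB : ∀ x, |U x| ≤ B) (hK : ∀ x y, |U x - U y| ≤ K * |x - y|)
    (h0 : Tendsto U (cocompact ℝ) (𝓝 0)) (h2 : MemLp U 2 volume)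
    (hS : ∀ l : ℝ, 1 < l → ∫ x, (κ * U x ^ 2 - ω * U x) * U (l * x) =
      l ^ α * ∫ x, U x * (κ * U (l * x) ^ 2 - ω * U (l * x)))
    (hP : ∀ l : ℝ, 1 < l → 0 ≤ ∫ x, (l ^ α * (κ * U (l * x) ^ 2 - ω * U (l * x)) -
      (κ * U x ^ 2 - ω * U x)) * (U (l * x) - U x)) :
    3 * α * ∫ x, U x * (κ * U x ^ 2 - ω * U x) = κ * ∫ x, U x ^ 3 := by
  obtain ⟨C, hC⟩ := integral_dilation_sub_sq_le hα hα1 hω hc hB hK h0 h2 hP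
  have hB0 : 0 ≤ B := (abs_nonneg _).trans (hB 0)
  set V : ℝ → ℝ := fun x => κ * U x ^ 2 - ω * U x with hV
  have hVm : MemLp V 2 volume := memLp_quadratic hc hB h2
  set N := 2 * |κ| * B + ω with hN
  have hN0 : 0 ≤ N := by positivity
  set T := ∫ x, U x * V x with hT
  set Q := ∫ x, U x ^ 3 with hQ
  set E := |κ| * (2 * B * C) + 3 * (N * (C + ∫ x, U x ^ 2)) with hE
  -- This function of `l` is constant at `1` up to second order, so its derivative there, `-κ Q + 3
  -- α T`, must vanish.
  have key : ∀ l : ℝ, 1 < l →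
      |(κ * Q * l⁻¹ + 3 * T * l ^ α) - (κ * Q * 1⁻¹ + 3 * T * 1 ^ α)| ≤ E * (l - 1) ^ 2 := by
    intro l hl
    have hl0 : 0 < l := by linarith
    have hl1 : 0 < l - 1 := by linarith
    obtain ⟨hr0, hr1⟩ := rpow_sub_one_le hα hα1 hl.le
    have hUl : MemLp (fun x => U (l * x)) 2 volume := memLp_comp_mul hl0.ne' h2
    have hVl : MemLp (fun x => V (l * x)) 2 volume := memLp_comp_mul hl0.ne' hVm
    have hWm : MemLp (fun x => U (l * x) - U x) 2 volume := hUl.sub h2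
    have hU3 : Integrable (fun x => U x ^ 3) := by
      have := h2.integrable_sq.bdd_mul (f := U) (c := B) hc.aestronglyMeasurable
        (Eventually.of_forall hB)
      refine this.congr (Eventually.of_forall fun x => ?_)
      simp only; ring
    have hUl3 : Integrable (fun x => U (l * x) ^ 3) := hU3.comp_mul_left' hl0.ne'
    have hi1 : Integrable (fun x => V x * U (l * x)) := hVm.integrable_mul hUl
    have hi2 : Integrable (fun x => U x * V (l * x)) := h2.integrable_mul hVl
    have hi3 : Integrable (fun x => U x * V x) := h2.integrable_mul hVm
    have e1 : κ * ∫ x, (U (l * x) - U x) ^ 3 =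
        κ * (l⁻¹ * Q) - κ * Q + 3 * ((l ^ α - 1) * ∫ x, U x * V (l * x)) := by
      -- The mixed cubic terms are exactly the antisymmetric expression in `U` and `V`, in which the
      -- linear part `ω U` cancels; `hS` then evaluates its integral.
      have : ∀ x, κ * (U (l * x) - U x) ^ 3 = (κ * U (l * x) ^ 3 - κ * U x ^ 3) +
          3 * (V x * U (l * x) - U x * V (l * x)) := fun x => by simp only [hV]; ring
      rw [← integral_const_mul]
      simp_rw [this]
      have hi4 : Integrable (fun x => κ * U (l * x) ^ 3 - κ * U x ^ 3) :=
        (hUl3.const_mul _).sub (hU3.const_mul _)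
      have hi5 : Integrable (fun x => 3 * (V x * U (l * x) - U x * V (l * x))) :=
        (hi1.sub hi2).const_mul _
      rw [integral_add hi4 hi5,
        integral_sub (hUl3.const_mul _) (hU3.const_mul _), integral_const_mul, integral_const_mul,
        integral_const_mul, integral_sub hi1 hi2, integral_comp_mul_pos hl0 (fun x => U x ^ 3),
        hS l hl]
      ring
    have e2 : |∫ x, (U (l * x) - U x) ^ 3| ≤ 2 * B * (C * (l - 1) ^ 2) := by
      refine (abs_integral_le_integral_abs).trans ?_
      calc ∫ x, |(U (l * x) - U x) ^ 3| ≤ ∫ x, 2 * B * (U (l * x) - U x) ^ 2 := by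
            refine integral_mono_of_nonneg (Eventually.of_forall fun x => abs_nonneg _)
              (hWm.integrable_sq.const_mul _) (Eventually.of_forall fun x => ?_)
            simp only [pow_succ _ 2, abs_mul, abs_pow, sq_abs]
            rw [mul_comm]
            gcongr
            calc |U (l * x) - U x| ≤ |U (l * x)| + |U x| := abs_sub _ _
              _ ≤ 2 * B := by linarith [hB x, hB (l * x)]
        _ ≤ _ := by rw [integral_const_mul]; gcongr; exact hC l hl
    have e3 : |(∫ x, U x * V (l * x)) - T| ≤ N * ((C + ∫ x, U x ^ 2) * (l - 1)) := by
      rw [hT, ← integral_sub hi2 hi3]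
      refine (abs_integral_le_integral_abs).trans ?_
      calc ∫ x, |U x * V (l * x) - U x * V x|
          ≤ ∫ x, N * ((l - 1)⁻¹ * (U (l * x) - U x) ^ 2 + (l - 1) * U x ^ 2) := by
            refine integral_mono_of_nonneg (Eventually.of_forall fun x => abs_nonneg _)
              (((hWm.integrable_sq.const_mul _).add (h2.integrable_sq.const_mul _)).const_mul _)
              (Eventually.of_forall fun x => ?_)
            have a1 : U x * V (l * x) - U x * V x =
              (κ * (U (l * x) + U x) - ω) * (U x * (U (l * x) - U x)) := by
                simp only [hV]; ring
            have a2 : |κ * (U (l * x) + U x) - ω| ≤ N := by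
              calc _ ≤ |κ * (U (l * x) + U x)| + |ω| := abs_sub _ _
                _ ≤ |κ| * (|U (l * x)| + |U x|) + ω := by
                    rw [abs_mul, abs_of_pos hω]; gcongr; exact abs_add_le _ _
                _ ≤ N := by nlinarith [hB x, hB (l * x), abs_nonneg κ]
            -- The factor `(l - 1)⁻¹` balances the two terms: with the `L²` dilation bound both
            -- integrate to `O(l - 1)`.
            have a3 : |U x * (U (l * x) - U x)| ≤
                (l - 1)⁻¹ * (U (l * x) - U x) ^ 2 + (l - 1) * U x ^ 2 := by
              rw [abs_mul, ← sq_abs (U (l * x) - U x), ← sq_abs (U x)]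
              generalize |U (l * x) - U x| = p
              generalize |U x| = q
              have : 0 ≤ (l - 1)⁻¹ * ((p - (l - 1) * q / 2) ^ 2 + 3 / 4 * ((l - 1) * q) ^ 2) := by
                positivity
              have a4 : (l - 1)⁻¹ * ((p - (l - 1) * q / 2) ^ 2 + 3 / 4 * ((l - 1) * q) ^ 2) =
                (l - 1)⁻¹ * p ^ 2 + (l - 1) * q ^ 2 - q * p := by field_simp; ring
              linarith
            simp only [a1]
            rw [abs_mul]
            gcongr
        _ = N * ((l - 1)⁻¹ * (∫ x, (U (l * x) - U x) ^ 2) + (l - 1) * ∫ x, U x ^ 2) := by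
            rw [integral_const_mul, integral_add (hWm.integrable_sq.const_mul _)
              (h2.integrable_sq.const_mul _), integral_const_mul, integral_const_mul]
        _ ≤ N * ((l - 1)⁻¹ * (C * (l - 1) ^ 2) + (l - 1) * ∫ x, U x ^ 2) := by
            gcongr; exact hC l hl
        _ = _ := by field_simp
    have e4 : (κ * Q * l⁻¹ + 3 * T * l ^ α) - (κ * Q * 1⁻¹ + 3 * T * 1 ^ α) =
        κ * (∫ x, (U (l * x) - U x) ^ 3) -
          3 * ((l ^ α - 1) * ((∫ x, U x * V (l * x)) - T)) := by
      rw [e1, Real.one_rpow]; ring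
    have e5 : |(l ^ α - 1) * ((∫ x, U x * V (l * x)) - T)| ≤
        (l - 1) * (N * ((C + ∫ x, U x ^ 2) * (l - 1))) := by
      rw [abs_mul, abs_of_nonneg hr0]
      exact mul_le_mul hr1 e3 (abs_nonneg _) hl1.le
    rw [e4]
    refine (abs_sub _ _).trans ?_
    rw [abs_mul, abs_mul 3, abs_of_pos (by norm_num : (0 : ℝ) < 3)]
    calc _ ≤ |κ| * (2 * B * (C * (l - 1) ^ 2)) +
          3 * ((l - 1) * (N * ((C + ∫ x, U x ^ 2) * (l - 1)))) := by gcongr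
      _ = _ := by rw [hE]; ring
  have hd : HasDerivAt (fun l : ℝ => κ * Q * l⁻¹ + 3 * T * l ^ α)
      (κ * Q * (-(1 ^ 2)⁻¹) + 3 * T * (α * 1 ^ (α - 1))) 1 :=
    ((hasDerivAt_inv one_ne_zero).const_mul _).add
      ((Real.hasDerivAt_rpow_const (Or.inl one_ne_zero)).const_mul _)
  have := eq_zero_of_hasDerivAt_of_le hd key
  rw [Real.one_rpow] at this
  linarith

end Pohozaev

end FBBM
end

/-! ### Symmetry of `D^α`, integral identities, and the momentum formula. -/

noncomputable section

namespace FBBM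

open Filter Topology

lemma integral_ofReal_mul_conj (f₁ f₂ : ℝ → ℝ) :
    ∫ x, (f₁ x : ℂ) * (starRingEnd ℂ) (f₂ x : ℂ) = ((∫ x, f₁ x * f₂ x : ℝ) : ℂ) := by
  rw [← integral_complex_ofReal]
  simp

lemma integral_symb_mul_conj (s : ℝ) (g : ℝ → ℂ) :
    ∫ ξ, ((symb s ξ : ℂ) * g ξ) * (starRingEnd ℂ) (g ξ) =
      ((∫ ξ, symb s ξ * ‖g ξ‖ ^ 2 : ℝ) : ℂ) := by
  rw [← integral_complex_ofReal]
  refine integral_congr_ae (Eventually.of_forall fun ξ => ?_)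
  simp only [mul_assoc, Complex.mul_conj, Complex.normSq_eq_norm_sq]
  push_cast
  rfl

section Symmetry

variable {α : ℝ} {U V : ℝ → ℝ} {g : ℝ → ℂ}

lemma isFT_comp_mul_symb {l : ℝ} (hl : 0 < l)
    (hV : IsFT (fun x => (V x : ℂ)) (fun ξ => (symb α ξ : ℂ) * g ξ)) :
    IsFT (fun x => ((l ^ α * V (l * x) : ℝ) : ℂ))
      (fun ξ => (symb α ξ : ℂ) * ((l : ℂ)⁻¹ * g (l⁻¹ * ξ))) := by
  refine ((hV.comp_mul hl).const_mul ((l ^ α : ℝ) : ℂ)).congr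
    (Eventually.of_forall fun x => ?_) (Eventually.of_forall fun ξ => ?_)
  · push_cast; rfl
  · have : symb α ξ = l ^ α * symb α (l⁻¹ * ξ) := by
      rw [← symb_mul hl, mul_inv_cancel_left₀ hl.ne']
    simp only [this]
    push_cast
    ring

/-- Here `V = D^α U`. The real symbol can be moved to either factor under Plancherel, and `D^α` of a
dilation produces `l^α`. -/
lemma integral_mul_dilation (hU : IsFT (fun x => (U x : ℂ)) g)
    (hV : IsFT (fun x => (V x : ℂ)) (fun ξ => (symb α ξ : ℂ) * g ξ)) {l : ℝ} (hl : 0 < l) :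
    ∫ x, V x * U (l * x) = l ^ α * ∫ x, U x * V (l * x) := by
  have h1 := (hU.comp_mul hl).integral_conj_mul hV
  have h2 := (isFT_comp_mul_symb hl hV).integral_conj_mul hU
  rw [integral_ofReal_mul_conj V (fun x => U (l * x))] at h1
  rw [integral_ofReal_mul_conj U (fun x => l ^ α * V (l * x))] at h2
  have h3 : ((∫ x, V x * U (l * x) : ℝ) : ℂ) = ((∫ x, U x * (l ^ α * V (l * x)) : ℝ) : ℂ) := by
    rw [h1, h2]
    refine integral_congr_ae (Eventually.of_forall fun ξ => ?_)
    simp only [map_mul, Complex.conj_ofReal]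
    ring
  rw [Complex.ofReal_inj.1 h3, ← integral_const_mul]
  congr 1
  ext x
  ring

lemma integral_dilation_sub_nonneg (hU : IsFT (fun x => (U x : ℂ)) g)
    (hV : IsFT (fun x => (V x : ℂ)) (fun ξ => (symb α ξ : ℂ) * g ξ)) {l : ℝ} (hl : 0 < l) :
    0 ≤ ∫ x, (l ^ α * V (l * x) - V x) * (U (l * x) - U x) := by
  have h1 : IsFT (fun x => ((U (l * x) - U x : ℝ) : ℂ))
      (fun ξ => (l : ℂ)⁻¹ * g (l⁻¹ * ξ) - g ξ) := by
    simpa using (hU.comp_mul hl).sub hU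
  have h2 : IsFT (fun x => ((l ^ α * V (l * x) - V x : ℝ) : ℂ))
      (fun ξ => (symb α ξ : ℂ) * ((l : ℂ)⁻¹ * g (l⁻¹ * ξ) - g ξ)) := by
    refine ((isFT_comp_mul_symb hl hV).sub hV).congr
      (Eventually.of_forall fun x => ?_) (Eventually.of_forall fun ξ => ?_)
    · push_cast; rfl
    · ring
  have h3 := h1.integral_conj_mul h2
  rw [integral_ofReal_mul_conj (fun x => l ^ α * V (l * x) - V x) (fun x => U (l * x) - U x),
    integral_symb_mul_conj α (fun ξ => (l : ℂ)⁻¹ * g (l⁻¹ * ξ) - g ξ)] at h3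
  rw [Complex.ofReal_inj.1 h3]
  exact integral_nonneg fun ξ => mul_nonneg (symb_nonneg _ _) (sq_nonneg _)

end Symmetry

/-- Solutions belong to `H^α` and satisfy the energy identity and Pohozaev's identity. -/
lemma Solves.identities {α ω κ : ℝ} {u : ℝ → ℝ} (hα : 1 / 3 < α) (hα1 : α < 1) (hω : 0 < ω)
    (h : Solves α ω κ u) :
    MemH α u ∧ (3 * α - 1) * (∫ ξ, symb α ξ * ‖fourierL2 u ξ‖ ^ 2) = ω * ∫ x, u x ^ 2 ∧
      3 * α * (∫ ξ, symb α ξ * ‖fourierL2 u ξ‖ ^ 2) = κ * ∫ x, u x ^ 3 := by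
  have hα0 : 0 < α := by linarith
  obtain ⟨U, huU, hc, ⟨B, hB⟩, ⟨K, hK⟩, h0⟩ := h.exists_representative hα hα1 hω
  have hgu := isFT_fourierL2 h.memLp
  set g := fourierL2 u
  have hg : IsFT (fun x => (U x : ℂ)) g := hgu.congr
    (by filter_upwards [huU] with x hx; rw [hx]) EventuallyEq.rfl
  have h2 : MemLp U 2 volume := by simpa using hg.memLp_left.re
  have hU2 : MemLp (fun x => ((U x ^ 2 : ℝ) : ℂ)) 2 volume := by
    have := memLp_quadratic (κ := 1) (ω := 0) hc hB h2
    simp only [one_mul, zero_mul, sub_zero] at this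
    exact this.ofReal
  have hU2i : Integrable (fun x => ((U x ^ 2 : ℝ) : ℂ)) := h2.integrable_sq.ofReal
  have heq := ((solves_iff hα0.le hg).1 (h.congr hα0.le huU)).2
  -- Boundedness puts `U²` in `L²`, so the equation holds in `L²`. This also yields membership in
  -- `H^α`.
  have hV : IsFT (fun x => ((κ * U x ^ 2 - ω * U x : ℝ) : ℂ))
      (fun ξ => (symb α ξ : ℂ) * g ξ) := by
    refine (((IsFT.of_integrable hU2 hU2i).const_mul (κ : ℂ)).sub (hg.const_mul (ω : ℂ))).congr
      (Eventually.of_forall fun x => ?_) ?_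
    · push_cast; rfl
    · filter_upwards [heq] with ξ hξ
      rw [← hξ, Complex.ofReal_add]
      ring
  have hpoh := pohozaev hα0 hα1 hω hc hB hK h0 h2
    (fun l hl => integral_mul_dilation hg hV (by linarith))
    (fun l hl => integral_dilation_sub_nonneg hg hV (by linarith))
  have hA : ∫ ξ, symb α ξ * ‖g ξ‖ ^ 2 = ∫ x, U x * (κ * U x ^ 2 - ω * U x) := by
    have h3 := hg.integral_conj_mul hV
    rw [integral_symb_mul_conj, integral_ofReal_mul_conj (fun x => κ * U x ^ 2 - ω * U x) U] at h3
    rw [← Complex.ofReal_inj.1 h3]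
    congr 1
    ext x
    ring
  have hU3i : Integrable (fun x => U x ^ 3) := by
    have := h2.integrable_sq.bdd_mul (f := U) (c := B) hc.aestronglyMeasurable
      (Eventually.of_forall hB)
    refine this.congr (Eventually.of_forall fun x => ?_)
    simp only; ring
  have hE : ∫ x, U x * (κ * U x ^ 2 - ω * U x) = κ * (∫ x, U x ^ 3) - ω * ∫ x, U x ^ 2 := by
    rw [← integral_const_mul, ← integral_const_mul,
      ← integral_sub (hU3i.const_mul _) (h2.integrable_sq.const_mul _)]
    congr 1
    ext x
    ring
  have hn : ∀ n : ℕ, ∫ x, u x ^ n = ∫ x, U x ^ n := fun n =>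
    integral_congr_ae (by filter_upwards [huU] with x hx; rw [hx])
  refine ⟨(memH_iff hα0.le hgu).2 hV.memLp_right, ?_, ?_⟩
  · rw [hn, hA]; linarith
  · rw [hn, hA]; linarith

lemma two_mul_momentum {α : ℝ} (hα : 0 ≤ α) {u : ℝ → ℝ} (h : MemH α u) :
    2 * momentum α u = (∫ ξ, symb α ξ * ‖fourierL2 u ξ‖ ^ 2) + ∫ x, u x ^ 2 := by
  have hg := isFT_fourierL2 h.1
  have hD := isFT_fracD ((memH_iff hα hg).1 h)
  have h1 := hg.integral_conj_mul hD
  rw [integral_symb_mul_conj] at h1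
  have hi1 : Integrable (fun x => fracD α u x * (u x : ℂ)) :=
    hD.memLp_left.integrable_mul hg.memLp_left
  have hi2 : Integrable (fun x => (u x : ℂ) * (u x : ℂ)) :=
    hg.memLp_left.integrable_mul hg.memLp_left
  have h2 := integral_ofReal_mul_conj u u
  simp only [Complex.conj_ofReal] at h1 h2
  unfold momentum
  simp only [add_mul]
  rw [integral_add hi1 hi2, h1, h2, ← Complex.ofReal_add, Complex.ofReal_re]
  simp only [← sq]
  ring

lemma integral_norm_fracD_sq {s : ℝ} (hs : 0 < s) {u : ℝ → ℝ} (h : MemH s u) :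
    ∫ x, ‖fracD s u x‖ ^ 2 = ∫ ξ, symb (2 * s) ξ * ‖fourierL2 u ξ‖ ^ 2 := by
  have hD := isFT_fracD ((memH_iff hs.le (isFT_fourierL2 h.1)).1 h)
  have h1 := hD.integral_conj_mul hD
  simp only [Complex.mul_conj, Complex.normSq_eq_norm_sq] at h1
  rw [integral_complex_ofReal, integral_complex_ofReal] at h1
  rw [Complex.ofReal_inj.1 h1]
  congr 1
  ext ξ
  rw [norm_mul, mul_pow, Complex.norm_of_nonneg (symb_nonneg s ξ), sq, symb_add s s ξ hs hs,
    two_mul]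

section Profiles

variable {α c : ℝ} {ψ : ℝ → ℝ}

lemma scaling_pos (hc : 1 < c) : 0 < (c / (c - 1)) ^ (1 / α) := by
  have : 0 < c - 1 := by linarith
  positivity

lemma scaling_rpow (hα : 0 < α) (hc : 1 < c) :
    ((c / (c - 1)) ^ (1 / α)) ^ α = c / (c - 1) := by
  have : 0 < c - 1 := by linarith
  rw [← Real.rpow_mul (by positivity), one_div_mul_cancel hα.ne', Real.rpow_one]

lemma isProfile_iff_solves_rescale (hα : 0 < α) (hc : 1 < c) :
    IsProfile α c ψ ↔ Solves α 1 1 (rescale α c ψ) := by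
  have hc1 : 0 < c - 1 := by linarith
  have hc1' : c - 1 ≠ 0 := hc1.ne'
  have hc0 : 0 < c := by linarith
  have hb : 0 < (c / (c - 1)) ^ (1 / α) := scaling_pos hc
  have hbα := scaling_rpow hα hc
  constructor
  · intro h
    have h1 := Solves.scale hα.le (one_div_ne_zero hc1.ne') hb h
    rw [hbα] at h1
    convert h1 using 1
    · field_simp
    · field_simp
    · rfl
  · intro h
    have h1 := Solves.scale hα.le hc1.ne' (inv_pos.2 hb) h
    rw [Real.inv_rpow hb.le, hbα] at h1
    unfold IsProfile
    convert h1 using 1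
    · field_simp
    · field_simp
    · ext x
      rw [rescale, mul_inv_cancel_left₀ hb.ne']
      field_simp

lemma integral_rescale_sq (hc : 1 < c) :
    ∫ x, rescale α c ψ x ^ 2 =
      1 / (c - 1) ^ 2 * ((c / (c - 1)) ^ (1 / α))⁻¹ * ∫ x, ψ x ^ 2 := by
  simp only [rescale, mul_pow]
  rw [integral_const_mul, integral_comp_mul_pos (scaling_pos hc) (fun x => ψ x ^ 2),
    div_pow, one_pow, mul_assoc]

lemma omega_pos (hc : 1 < c) : 0 < 1 - 1 / c := by
  rw [sub_pos, div_lt_one (by linarith)]; exact hc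

lemma IsProfile.momentum_eq (hα : 1 / 3 < α) (hα1 : α < 1) (hc : 1 < c) (h : IsProfile α c ψ) :
    2 * momentum α ψ =
      (1 / (3 * α - 1) * c ^ (1 / α - 1) * (c - 1) ^ (3 - 1 / α)
        + c ^ (1 / α) * (c - 1) ^ (2 - 1 / α)) * ∫ x, rescale α c ψ x ^ 2 := by
  obtain ⟨h1, h2, -⟩ := Solves.identities hα hα1 (omega_pos hc) h
  rw [two_mul_momentum (by linarith) h1, integral_rescale_sq hc]
  have hc1 : 0 < c - 1 := by linarith
  have hc0 : 0 < c := by linarith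
  have h3 : 0 < 3 * α - 1 := by linarith
  have hA : ∫ ξ, symb α ξ * ‖fourierL2 ψ ξ‖ ^ 2 = (1 - 1 / c) * (∫ x, ψ x ^ 2) / (3 * α - 1) := by
    rw [← h2]; field_simp
  rw [hA, Real.div_rpow hc0.le hc1.le, Real.rpow_sub hc0, Real.rpow_sub hc1, Real.rpow_sub hc1,
    Real.rpow_one, Real.rpow_ofNat, Real.rpow_ofNat]
  have p1 : 0 < c ^ (1 / α) := by positivity
  have p2 : 0 < (c - 1) ^ (1 / α) := by positivity
  field_simp

end Profiles

end FBBM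
end

/-! ### The threshold speed, the sign of the derivative, and the Weinstein functional. -/

noncomputable section

namespace FBBM

open Filter Topology

section Threshold

variable {α c : ℝ}

/-- Completing the square reduces every statement on `c₀` to comparing `6αr - 2` with the square
root. -/
lemma quadratic_eq (hα : 1 / 3 < α) (r : ℝ) :
    6 * α ^ 2 * r ^ 2 - 4 * α * r + 1 - α = ((6 * α * r - 2) ^ 2 - √(2 * (3 * α - 1)) ^ 2) / 6 := by
  rw [Real.sq_sqrt (by linarith)]
  ring

lemma isGreatest_c₀ (hα : 1 / 3 < α) :
    IsGreatest {r : ℝ | 6 * α ^ 2 * r ^ 2 - 4 * α * r + 1 - α = 0} (c₀ α) := by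
  have hα0 : 0 < α := by linarith
  constructor
  · rw [mem_ofPred_eq, quadratic_eq hα, c₀, mul_div_cancel₀ _ (by positivity)]
    ring
  · intro r hr
    rw [mem_ofPred_eq, quadratic_eq hα, div_eq_zero_iff, or_iff_left (by norm_num), sub_eq_zero] at hr
    rw [c₀, le_div_iff₀ (by positivity)]
    have := le_of_abs_le (le_of_eq ((sq_eq_sq_iff_abs_eq_abs _ _).1 hr))
    rw [abs_of_nonneg (Real.sqrt_nonneg _)] at this
    linarith

lemma one_lt_c₀ (hα : 1 / 3 < α) (h : α < 1 / 2) : 1 < c₀ α := by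
  rw [c₀, one_lt_div (by linarith)]
  have : 6 * α - 2 < √(2 * (3 * α - 1)) := Real.lt_sqrt_of_sq_lt (by nlinarith)
  linarith

lemma c₀_le_one (h : 1 / 2 ≤ α) : c₀ α ≤ 1 := by
  rw [c₀, div_le_one (by linarith)]
  have : √(2 * (3 * α - 1)) ≤ 6 * α - 2 := Real.sqrt_le_iff.2 ⟨by linarith, by nlinarith⟩
  linarith

lemma quadratic_pos (hα : 1 / 3 < α) (h : c₀ α < c) :
    0 < 6 * α ^ 2 * c ^ 2 - 4 * α * c + 1 - α := by
  rw [quadratic_eq hα]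
  rw [c₀, div_lt_iff₀ (by linarith)] at h
  have : √(2 * (3 * α - 1)) ^ 2 < (6 * α * c - 2) ^ 2 :=
    pow_lt_pow_left₀ (by linarith) (Real.sqrt_nonneg _) two_ne_zero
  linarith

/-- For `c > 1` and `α > 1/3` one has `6αc - 2 > 0`, so the smaller root plays no role. -/
lemma quadratic_neg (hα : 1 / 3 < α) (hc : 1 < c) (h : c < c₀ α) :
    6 * α ^ 2 * c ^ 2 - 4 * α * c + 1 - α < 0 := by
  rw [quadratic_eq hα]
  rw [c₀, lt_div_iff₀ (by linarith)] at h
  have : (6 * α * c - 2) ^ 2 < √(2 * (3 * α - 1)) ^ 2 :=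
    pow_lt_pow_left₀ (by linarith) (by nlinarith) two_ne_zero
  linarith

end Threshold

/-- The dependence of the momentum on the speed. -/
def speedFactor (α c : ℝ) : ℝ :=
  1 / (3 * α - 1) * c ^ (1 / α - 1) * (c - 1) ^ (3 - 1 / α) + c ^ (1 / α) * (c - 1) ^ (2 - 1 / α)

lemma hasDerivAt_speedFactor {α c : ℝ} (hα : 1 / 3 < α) (hc : 1 < c) :
    HasDerivAt (speedFactor α)
      (c ^ (1 / α) / c ^ 2 * ((c - 1) / (c - 1) ^ (1 / α)) / (α * (3 * α - 1)) *
        (6 * α ^ 2 * c ^ 2 - 4 * α * c + 1 - α)) c := by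
  have hc0 : 0 < c := by linarith
  have hc1 : 0 < c - 1 := by linarith
  have h3 : 0 < 3 * α - 1 := by linarith
  have hα0 : 0 < α := by linarith
  have d1 : ∀ p : ℝ, HasDerivAt (fun c : ℝ => c ^ p) (p * c ^ (p - 1)) c := fun p =>
    Real.hasDerivAt_rpow_const (Or.inl hc0.ne')
  have d2 : ∀ p : ℝ, HasDerivAt (fun c : ℝ => (c - 1) ^ p) (1 * p * (c - 1) ^ (p - 1)) c :=
    fun p => ((hasDerivAt_id c).sub_const 1).rpow_const (Or.inl hc1.ne')
  have h := (((d1 (1 / α - 1)).const_mul (1 / (3 * α - 1))).mul (d2 (3 - 1 / α))).add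
    ((d1 (1 / α)).mul (d2 (2 - 1 / α)))
  refine h.congr_deriv ?_
  simp only [Real.rpow_sub hc0, Real.rpow_sub hc1, Real.rpow_one, Real.rpow_ofNat]
  have p1 : 0 < c ^ (1 / α) := by positivity
  have p2 : 0 < (c - 1) ^ (1 / α) := by positivity
  -- All remaining powers are integral, so with these two as free variables the claim is a rational
  -- identity.
  generalize c ^ (1 / α) = X at *
  generalize (c - 1) ^ (1 / α) = Y at *
  field_simp
  ring

lemma hasMomentumSigns_of_eq {α N : ℝ} (hα : 1 / 3 < α) (hN : 0 < N) {M : ℝ → ℝ}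
    (hM : ∀ c, 1 < c → 2 * M c = speedFactor α c * N) : HasMomentumSigns α M := by
  have hd : ∀ c, 1 < c → HasDerivAt M
      (c ^ (1 / α) / c ^ 2 * ((c - 1) / (c - 1) ^ (1 / α)) / (α * (3 * α - 1)) * (N / 2) *
        (6 * α ^ 2 * c ^ 2 - 4 * α * c + 1 - α)) c := fun c hc => by
    refine (((hasDerivAt_speedFactor hα hc).mul_const (N / 2)).congr_of_eventuallyEq ?_).congr_deriv
      (by ring)
    filter_upwards [lt_mem_nhds hc] with x hx
    linarith [hM x hx]
  have hpos : ∀ c, 1 < c →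
      0 < c ^ (1 / α) / c ^ 2 * ((c - 1) / (c - 1) ^ (1 / α)) / (α * (3 * α - 1)) * (N / 2) :=
    fun c hc => by
      have hc0 : 0 < c := by linarith
      have hc1 : 0 < c - 1 := by linarith
      have h3 : 0 < 3 * α - 1 := by linarith
      have hα0 : 0 < α := by linarith
      positivity
  refine ⟨fun c hc => (hd c hc).differentiableAt, fun h c hc => ?_, fun h c hc => ?_,
    fun h c hc hc' => ?_⟩
  · rw [(hd c hc).deriv]
    exact mul_pos (hpos c hc) (quadratic_pos hα ((c₀_le_one h).trans_lt hc))
  · have hc1 := (one_lt_c₀ hα h).trans hc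
    rw [(hd c hc1).deriv]
    exact mul_pos (hpos c hc1) (quadratic_pos hα hc)
  · rw [(hd c hc).deriv]
    exact mul_neg_of_pos_of_neg (hpos c hc) (quadratic_neg hα hc hc')

lemma integral_sq_pos {u : ℝ → ℝ} (h : MemLp (fun x => (u x : ℂ)) 2 volume)
    (h0 : ¬ ∀ᵐ x, u x = 0) : 0 < ∫ x, u x ^ 2 := by
  have h2 : MemLp u 2 volume := by simpa using h.re
  refine lt_of_le_of_ne (integral_nonneg fun x => sq_nonneg _) fun h3 => h0 ?_
  have := (integral_eq_zero_iff_of_nonneg (fun x => sq_nonneg (u x)) h2.integrable_sq).1 h3.symm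
  filter_upwards [this] with x hx
  exact pow_eq_zero_iff two_ne_zero |>.1 hx

lemma not_ae_eq_zero_of_ae_pos {u : ℝ → ℝ} (h : ∀ᵐ x, 0 < u x) : ¬ ∀ᵐ x, u x = 0 := fun h0 => by
  have : ∀ᵐ _ : ℝ, False := by
    filter_upwards [h, h0] with x h1 h2
    exact h1.ne' h2
  exact NeZero.ne (volume : Measure ℝ) (ae_eq_bot.1 (eventually_false_iff_eq_bot.1 this))

/-- To be read with `d = c - 1`, `q = 3α - 1`, `N = ‖T_c φ‖²`, `b` the dilation factor and `b^{-α} =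
1 - 1/c`. The two exponents in the numerator add up to `3/2`, and all powers of `b` and `d` cancel.
-/
lemma weinstein_scaling {α b d N q : ℝ} (hα : 0 < α) (hb : 0 < b) (hd : 0 < d) (hN : 0 < N)
    (hq : 0 < q) :
    (b ^ (-α) * (d ^ 2 * b * N) / q) ^ (1 / (2 * α)) *
      (d ^ 2 * b * N) ^ (1 / (2 * α) * (α - 1) + 1) / (3 * α * d * (d ^ 2 * b * N) / q) =
      q / (3 * α * q ^ (1 / (2 * α))) * √N := by
  have hB : 0 < d ^ 2 * b * N := by positivity
  have e1 : (b ^ (-α)) ^ (1 / (2 * α)) = (√b)⁻¹ := by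
    rw [← Real.rpow_mul hb.le, Real.sqrt_eq_rpow, ← Real.rpow_neg hb.le]
    congr 1
    field_simp
  have e2 : √(d ^ 2 * b * N) = d * √b * √N := by
    rw [Real.sqrt_mul (by positivity), Real.sqrt_mul (by positivity), Real.sqrt_sq hd.le]
  have e3 : (d ^ 2 * b * N) ^ (1 / (2 * α)) *
      (d ^ 2 * b * N) ^ (1 / (2 * α) * (α - 1) + 1) = (d ^ 2 * b * N) * (d * √b * √N) := by
    rw [← e2, ← Real.rpow_add hB, Real.sqrt_eq_rpow]
    nth_rewrite 2 [← Real.rpow_one (d ^ 2 * b * N)]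
    rw [← Real.rpow_add hB]
    congr 1
    field_simp
    ring
  rw [Real.div_rpow (by positivity) hq.le, Real.mul_rpow (by positivity) hB.le, e1]
  have e4 : (√b)⁻¹ * (d ^ 2 * b * N) ^ (1 / (2 * α)) / q ^ (1 / (2 * α)) *
      (d ^ 2 * b * N) ^ (1 / (2 * α) * (α - 1) + 1) =
      (√b)⁻¹ / q ^ (1 / (2 * α)) * ((d ^ 2 * b * N) ^ (1 / (2 * α)) *
      (d ^ 2 * b * N) ^ (1 / (2 * α) * (α - 1) + 1)) := by ring
  have hsb : 0 < √b := Real.sqrt_pos.2 hb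
  rw [e4, e3]
  field_simp

lemma IsGroundState.weinstein_eq {α c : ℝ} {φ : ℝ → ℝ} (hα : 1 / 3 < α) (hα1 : α < 1)
    (hc : 1 < c) (h : IsGroundState α c φ) :
    weinstein α φ = (3 * α - 1) / (3 * α * (3 * α - 1) ^ (1 / (2 * α))) *
      √(∫ x, rescale α c φ x ^ 2) := by
  obtain ⟨hp, -, hpos, -⟩ := h
  have hα0 : 0 < α := by linarith
  have hc1 : 0 < c - 1 := by linarith
  have hc0 : 0 < c := by linarith
  have hq : 0 < 3 * α - 1 := by linarith
  obtain ⟨-, h2, h3⟩ := Solves.identities hα hα1 (omega_pos hc) hp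
  have hB := integral_sq_pos hp.memLp (not_ae_eq_zero_of_ae_pos hpos)
  have hN := integral_rescale_sq (α := α) (ψ := φ) hc
  have hb : 0 < (c / (c - 1)) ^ (1 / α) := scaling_pos hc
  have hbα := scaling_rpow hα0 hc
  set b := (c / (c - 1)) ^ (1 / α)
  set N := ∫ x, rescale α c φ x ^ 2
  have hN0 : 0 < N := by rw [hN]; positivity
  have hBN : ∫ x, φ x ^ 2 = (c - 1) ^ 2 * b * N := by rw [hN]; field_simp
  rw [← weinstein_scaling hα0 hb hc1 hN0 hq, weinstein, integral_norm_fracD_sq (by linarith) hp.1]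
  have hA : ∫ ξ, symb (2 * (α / 2)) ξ * ‖fourierL2 φ ξ‖ ^ 2 =
      b ^ (-α) * ((c - 1) ^ 2 * b * N) / (3 * α - 1) := by
    rw [mul_div_cancel₀ _ two_ne_zero, Real.rpow_neg hb.le, hbα, ← hBN, eq_div_iff hq.ne', mul_comm,
      h2]
    field_simp
  -- Pohozaev's identity evaluates `∫ φ³`; positivity of `φ` identifies it with the denominator of
  -- the functional.
  have hC : ∫ x, |φ x| ^ 3 = 3 * α * (c - 1) * ((c - 1) ^ 2 * b * N) / (3 * α - 1) := by
    have h4 : ∫ x, |φ x| ^ 3 = ∫ x, φ x ^ 3 :=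
      integral_congr_ae (by filter_upwards [hpos] with x hx; rw [abs_of_pos hx])
    rw [mul_div_cancel₀ _ two_ne_zero] at hA
    rw [hA, Real.rpow_neg hb.le, hbα] at h3
    rw [h4]
    field_simp at h3 ⊢
    linear_combination -h3
  simp only [sq_abs]
  rw [hA, hBN, hC]

end FBBM

end

theorem mainTheorem10 (α : ℝ) (hα₁ : 1 / 3 < α) (hα₂ : α < 1) :
    -- the scaling maps profiles with speed `c` exactly onto solutions of `D^α Ψ + Ψ - Ψ² = 0`
    (∀ c : ℝ, 1 < c → ∀ ψ : ℝ → ℝ,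
      FBBM.IsProfile α c ψ ↔ FBBM.Solves α 1 1 (FBBM.rescale α c ψ)) ∧
    -- the momentum is well defined and given by the formula
    (∀ c : ℝ, 1 < c → ∀ ψ : ℝ → ℝ, FBBM.IsProfile α c ψ →
      FBBM.MemH α ψ ∧
      2 * FBBM.momentum α ψ =
        (1 / (3 * α - 1) * c ^ (1 / α - 1) * (c - 1) ^ (3 - 1 / α)
          + c ^ (1 / α) * (c - 1) ^ (2 - 1 / α)) * ∫ x, FBBM.rescale α c ψ x ^ 2) ∧
    -- the threshold speed
    IsGreatest {r : ℝ | 6 * α ^ 2 * r ^ 2 - 4 * α * r + 1 - α = 0} (FBBM.c₀ α) ∧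
    (α < 1 / 2 → 1 < FBBM.c₀ α) ∧
    -- families of profiles that come from one nontrivial `Ψ`, up to translations
    (∀ (ψ : ℝ → ℝ → ℝ) (Ψ : ℝ → ℝ),
      (∀ c : ℝ, 1 < c → FBBM.IsProfile α c (ψ c)) →
      (∀ c : ℝ, 1 < c → ∃ y : ℝ, ∀ᵐ x : ℝ, FBBM.rescale α c (ψ c) x = Ψ (x + y)) →
      ¬ (∀ᵐ x : ℝ, Ψ x = 0) →
      FBBM.HasMomentumSigns α (fun c => FBBM.momentum α (ψ c))) ∧
    -- families of ground states
    (∀ Φ : ℝ → ℝ → ℝ,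
      (∀ c : ℝ, 1 < c → FBBM.IsGroundState α c (Φ c)) →
      FBBM.HasMomentumSigns α (fun c => FBBM.momentum α (Φ c))) := by
  have hα0 : 0 < α := by linarith
  refine ⟨fun c hc ψ => FBBM.isProfile_iff_solves_rescale hα0 hc, fun c hc ψ h =>
    ⟨(FBBM.Solves.identities hα₁ hα₂ (FBBM.omega_pos hc) h).1, h.momentum_eq hα₁ hα₂ hc⟩,
    FBBM.isGreatest_c₀ hα₁, FBBM.one_lt_c₀ hα₁, fun ψ Ψ hψ hΨ h0 => ?_, fun Φ hΦ => ?_⟩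
  · have hN : ∀ c, 1 < c → ∫ x, FBBM.rescale α c (ψ c) x ^ 2 = ∫ x, Ψ x ^ 2 := fun c hc => by
      obtain ⟨y, hy⟩ := hΨ c hc
      rw [← integral_add_right_eq_self (fun x => Ψ x ^ 2) y]
      exact integral_congr_ae (by filter_upwards [hy] with x hx; rw [hx])
    have hpos : 0 < ∫ x, Ψ x ^ 2 := by
      rw [← hN 2 one_lt_two]
      refine FBBM.integral_sq_pos ((FBBM.isProfile_iff_solves_rescale hα0 one_lt_two).1
        (hψ 2 one_lt_two)).memLp fun hz => h0 ?_
      obtain ⟨y, hy⟩ := hΨ 2 one_lt_two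
      have h1 : ∀ᵐ x : ℝ, Ψ (x + y) = 0 := by
        filter_upwards [hy, hz] with x h1 h2
        rw [← h1, h2]
      have h2 := (measurePreserving_sub_right volume y).quasiMeasurePreserving.ae h1
      simpa using h2
    exact FBBM.hasMomentumSigns_of_eq hα₁ hpos fun c hc => by
      rw [(hψ c hc).momentum_eq hα₁ hα₂ hc, hN c hc, FBBM.speedFactor]
  · have hnz : ∀ c, 1 < c → ¬ ∀ᵐ x, Φ c x = 0 := fun c hc =>
      FBBM.not_ae_eq_zero_of_ae_pos (hΦ c hc).2.2.1
    have hk : 0 < (3 * α - 1) / (3 * α * (3 * α - 1) ^ (1 / (2 * α))) := by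
      have : 0 < 3 * α - 1 := by linarith
      positivity
    have hpos : ∀ c, 1 < c → 0 < ∫ x, FBBM.rescale α c (Φ c) x ^ 2 := fun c hc => by
      have h1 := FBBM.integral_sq_pos (hΦ c hc).1.memLp (hnz c hc)
      have h2 := FBBM.scaling_pos (α := α) hc
      have h3 : 0 < c - 1 := by linarith
      rw [FBBM.integral_rescale_sq hc]
      positivity
    -- The ground state at speed `c'` is a competitor for the one at speed `c`. Exchanging the
    -- speeds gives equality, and speed `2` serves as the reference.
    have hle : ∀ c c', 1 < c → 1 < c' →
        ∫ x, FBBM.rescale α c (Φ c) x ^ 2 ≤ ∫ x, FBBM.rescale α c' (Φ c') x ^ 2 :=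
      fun c c' hc hc' => by
        have h := (hΦ c hc).2.2.2 (Φ c') (hΦ c' hc').1.1 (hnz c' hc')
        rw [(hΦ c hc).weinstein_eq hα₁ hα₂ hc, (hΦ c' hc').weinstein_eq hα₁ hα₂ hc'] at h
        exact (Real.sqrt_le_sqrt_iff (hpos c' hc').le).1 (le_of_mul_le_mul_left h hk)
    exact FBBM.hasMomentumSigns_of_eq hα₁ (hpos 2 one_lt_two) fun c hc => by
      rw [(hΦ c hc).1.momentum_eq hα₁ hα₂ hc, FBBM.speedFactor,
        (hle c 2 hc one_lt_two).antisymm (hle 2 c one_lt_two hc)]
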